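/- Lemma 5.2. All manifolds are finite-dimensional, Hausdorff and second countable, and $X$, $Y$ have no boundary. A smooth map $f : X \to Y$ is *transversal to a submanifold* $Z \subset Y$ *at* $x \in X$ if either $f(x) \notin Z$, or $df_x(T_xX) + T_{f(x)}Z = T_{f(x)}Y$; it is *transversal to* $Z$ if this holds at every $x \in X$. The space $C^\infty(X,Y)$ of smooth maps carries the (weak) $C^\infty$ topology, i.e. the topology of uniform convergence, in charts, of all derivatives on compact sets. Let $B$ be a Baire space, $X$ and $Y$ smooth manifolds, and $Z \subset Y$ an embedded submanifold (possibly with boundary or corners, not necessarily closed). Let $$\Phi : B \to C^\infty(X, Y)$$ be a continuous map. Suppose that for each $(b_0, x_0) \in B \times X$ for which $\Phi(b_0)$ is not transversal to $Z$ at $x_0$, there exist an integer $n \ge 0$, an open neighborhood $S$ of the origin in $\mathbb{R}^n$, an open neighborhood $U$ of $b_0$ in $B$, and a continuous map $\beta : U \times S \to B$ such that: 1. $\beta(b, 0) = b$ for each $b \in U$. 2. If $\Psi(b, s, x) = \Phi(\beta(b, s))(x)$, then $\Psi(b,\cdot,\cdot) : S \times X \to Y$ is smooth for each $b \in U$, and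 $b \mapsto \Psi(b, \cdot, \cdot)$ is a continuous map $U \to C^\infty(S \times X, Y)$. 3. $(s, x) \mapsto \Psi(b_0, s, x)$ is transversal to $Z$ at $(0, x_0)$. Then $\{b \in B : \Phi(b) \text{ is transversal to } Z\}$ is residual in $B$, that is, it contains a countable intersection of open dense subsets of $B$. -/

import Mathlib

open scoped Manifold ContDiff Topology

section SmoothMaps

variable {E E' F H H' G : Type*}
  [NormedAddCommGroup E] [NormedSpace ℝ E] [NormedAddCommGroup E'] [NormedSpace ℝ E']
  [NormedAddCommGroup F] [NormedSpace ℝ F]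
  [TopologicalSpace H] [TopologicalSpace H'] [TopologicalSpace G]
  {I : ModelWithCorners ℝ E H} {J : ModelWithCorners ℝ E' H'}
  {X Y : Type*} [TopologicalSpace X] [ChartedSpace H X] [TopologicalSpace Y] [ChartedSpace H' Y]

/-- The subbasic set `N^r(f; φ, ψ, K, ε)` of the `C^∞` topology: the smooth maps `g` that map `K`
into the domain of the chart `ψ` of `Y` and whose representative in the charts `φ`, `ψ` is
`ε`-close to that of `f`, uniformly on `K`, together with all derivatives of order at most `r`. -/
def smoothNhd (f : C^∞⟮I, X; J, Y⟯) (φ : OpenPartialHomeomorph X H)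
    (ψ : OpenPartialHomeomorph Y H') (K : Set X) (r : ℕ) (ε : ℝ) : Set C^∞⟮I, X; J, Y⟯ :=
  {g | Set.MapsTo g K ψ.source ∧ ∀ x ∈ K, ∀ k ≤ r,
    ‖iteratedFDerivWithin ℝ k (ψ.extend J ∘ g ∘ (φ.extend I).symm) (Set.range I) (φ.extend I x) -
      iteratedFDerivWithin ℝ k (ψ.extend J ∘ f ∘ (φ.extend I).symm) (Set.range I)
        (φ.extend I x)‖ < ε}

/-- The (weak, or compact-open) `C^∞` topology on `C^∞(X, Y)`: uniform convergence of all
derivatives, in charts, on compact sets. It is generated by the sets `N^r(f; φ, ψ, K, ε)` where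
`φ`, `ψ` are smooth charts, `K` is a compact subset of the domain of `φ`, `f` maps `K` into the
domain of `ψ`, `r` is finite and `ε` is positive. -/
instance smoothMapTopology : TopologicalSpace C^∞⟮I, X; J, Y⟯ :=
  TopologicalSpace.generateFrom
    {N | ∃ (f : C^∞⟮I, X; J, Y⟯) (φ : OpenPartialHomeomorph X H)
      (ψ : OpenPartialHomeomorph Y H') (K : Set X) (r : ℕ) (ε : ℝ),
      φ ∈ IsManifold.maximalAtlas I ∞ X ∧ ψ ∈ IsManifold.maximalAtlas J ∞ Y ∧
      IsCompact K ∧ K ⊆ φ.source ∧ Set.MapsTo f K ψ.source ∧ 0 < ε ∧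
      N = smoothNhd f φ ψ K r ε}

/-- `f : X → Y` is transversal to the submanifold `Z ⊆ Y` at `x`: if `z = f x` lies in `Z`, then
`df_x (T_x X) + T_z Z = T_z Y`, where `T_z Z` is the image of the differential at `z` of the
inclusion of `Z`. -/
def IsTransversalAt (I : ModelWithCorners ℝ E H) (J : ModelWithCorners ℝ E' H')
    (K : ModelWithCorners ℝ F G) (Z : Set Y) [ChartedSpace G Z] (f : X → Y) (x : X) : Prop :=
  ∀ hx : f x ∈ Z,
    (mfderiv I J f x).range ⊔ (mfderiv K J (Subtype.val : Z → Y) ⟨f x, hx⟩).range = ⊤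

/-- `f : X → Y` is transversal to `Z` if it is so at every point. -/
def IsTransversal (I : ModelWithCorners ℝ E H) (J : ModelWithCorners ℝ E' H')
    (K : ModelWithCorners ℝ F G) (Z : Set Y) [ChartedSpace G Z] (f : X → Y) : Prop :=
  ∀ x, IsTransversalAt I J K Z f x

end SmoothMaps

/-! The bad event is cut into countably many pieces, each of which is avoided by an open dense set
of parameters. Cover `X` by compact sets `T_i` and `Z` by compact sets `Q_j`; let `G_ij` be the set
of `b` such that `Φ b` is transversal to `Z` at each point of `T_i` that it maps into `Q_j`. The
intersection of all `G_ij` is the set in question.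

Openness. Near a point of `Z`, a chart of `Y` and a linear map `P` turn transversality into
surjectivity of `P` composed with a first derivative, also when `Z` has corners. Surjectivity is an
open condition and first derivatives depend continuously on the map and the point, so transversality
persists near a point mapped into `Z`. Since `Q_j` is closed in `Y`, a point mapped outside `Q_j`
stays outside. Compactness of `T_i` concludes (`isOpen_setOf_isTransversalAt`). Without the `Q_j`
this fails when `Z` is not closed.

Density. At a point of non-transversality the family `Ψ b₀` is transversal at `(0, x₀)`. By
continuity of `Ψ`, the surjectivity persists for all `(b, s, x)` near `(b₀, 0, x₀)`. For each such
`b`, Sard's theorem applied to the projection of the zero set to the parameter space gives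
arbitrarily small `s` for which the partial map is transversal near `x₀`, and `β (b, s)` is then a
good parameter close to `b` (`exists_isOpen_isTransversalAt_near`). Finitely many such neighborhoods
cover `T_i`, and finitely many open sets dense near `b₀` have an intersection dense near `b₀`.

Sard's theorem is proved by induction on the dimension of the source. Its flat part uses Hausdorff
dimension instead of counting cubes. -/

section Sard

open MeasureTheory Set Function Module

universe u v

/-! ### Sard's theorem and parametric transversality in vector spaces -/

section Linear

variable {E F : Type*} [NormedAddCommGroup E] [NormedSpace ℝ E]
  [NormedAddCommGroup F] [NormedSpace ℝ F] [FiniteDimensional ℝ F]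

/-- Surjective continuous linear maps onto a finite-dimensional space form an open set. -/
theorem isOpen_setOf_surjective_clm : IsOpen {L : E →L[ℝ] F | Surjective L} := by
  rw [isOpen_iff_mem_nhds]
  intro L hL
  have : CompleteSpace F := FiniteDimensional.complete ℝ F
  obtain ⟨R, hR⟩ := L.exists_rightInverse_of_surjective (LinearMap.range_eq_top.2 hL)
  have hc : Continuous fun L' : E →L[ℝ] F => L' ∘L R := by fun_prop
  have h1 := (ContinuousLinearEquiv.refl ℝ F).nhds
  have h2 : ((ContinuousLinearEquiv.refl ℝ F : F ≃L[ℝ] F) : F →L[ℝ] F) = L ∘L R := by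
    rw [hR]; rfl
  rw [h2] at h1
  filter_upwards [hc.continuousAt.preimage_mem_nhds h1]
  rintro L' ⟨e, he⟩ y
  refine ⟨R (e.symm y), ?_⟩
  have := DFunLike.congr_fun he (e.symm y)
  simpa using this.symm

end Linear

section Straightening

variable {E C : Type*} [NormedAddCommGroup E] [NormedSpace ℝ E] [FiniteDimensional ℝ E]
  [NormedAddCommGroup C] [NormedSpace ℝ C] [FiniteDimensional ℝ C]

/-- Near a point where its differential is onto, a smooth map is a projection in suitable
smooth coordinates. -/
theorem exists_straightening {w : E → C} {U : Set E} (hU : IsOpen U) (hw : ContDiffOn ℝ ∞ w U)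
    {x : E} (hx : x ∈ U) (hs : Surjective (fderiv ℝ w x)) :
    ∃ K : Submodule ℝ E, K = (fderiv ℝ w x).ker ∧
      ∃ e : OpenPartialHomeomorph E (C × K), x ∈ e.source ∧ e.source ⊆ U ∧
      (∀ z, (e z).1 = w z) ∧ ContDiffOn ℝ ∞ e.symm e.target := by
  refine ⟨_, rfl, ?_⟩
  have : CompleteSpace E := FiniteDimensional.complete ℝ E
  have : CompleteSpace C := FiniteDimensional.complete ℝ C
  obtain ⟨R, hR⟩ := (fderiv ℝ w x).exists_rightInverse_of_surjective (LinearMap.range_eq_top.2 hs)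
  set A := ContinuousLinearEquiv.equivOfRightInverse (fderiv ℝ w x) R
    (fun y => DFunLike.congr_fun hR y) with hA
  set P : E → C × (fderiv ℝ w x).ker := fun z => (w z, (A z).2) with hP
  have hPs : ContDiffOn ℝ ∞ P U :=
    hw.prodMk ((contDiff_snd.comp A.contDiff).contDiffOn)
  have hwx : ContDiffAt ℝ ∞ w x := hw.contDiffAt (hU.mem_nhds hx)
  have hPx : HasStrictFDerivAt P (A : E →L[ℝ] C × (fderiv ℝ w x).ker) x := by
    have h1 := (hwx.hasStrictFDerivAt (by simp)).prodMk
      (((ContinuousLinearMap.snd ℝ C (fderiv ℝ w x).ker).comp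
        (A : E →L[ℝ] C × (fderiv ℝ w x).ker)).hasStrictFDerivAt (x := x))
    refine h1.congr_fderiv ?_
    refine ContinuousLinearMap.ext fun z => Prod.ext ?_ rfl
    exact (ContinuousLinearEquiv.fst_equivOfRightInverse _ _ _ _).symm
  -- The local inverse is smooth where the differential of `P` is invertible, so the source is cut
  -- down to that open set.
  have hN : IsOpen (U ∩ fderiv ℝ P ⁻¹' range
      (fun L : E ≃L[ℝ] C × (fderiv ℝ w x).ker => (L : E →L[ℝ] C × (fderiv ℝ w x).ker))) :=
    (hPs.continuousOn_fderiv_of_isOpen hU (by simp)).isOpen_inter_preimage hU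
      ContinuousLinearEquiv.isOpen
  refine ⟨(hPx.toOpenPartialHomeomorph P).restrOpen _ hN, ?_, ?_, ?_, ?_⟩
  · refine ⟨hPx.mem_toOpenPartialHomeomorph_source, hx, ?_⟩
    rw [mem_preimage, hPx.hasFDerivAt.fderiv]
    exact ⟨A, rfl⟩
  · exact fun z hz => hz.2.1
  · exact fun z => rfl
  · intro q hq
    have hz := ((hPx.toOpenPartialHomeomorph P).restrOpen _ hN).map_target hq
    obtain ⟨-, hzU, L, hL⟩ := hz
    have hPz := hPs.contDiffAt (hU.mem_nhds hzU)
    refine (OpenPartialHomeomorph.contDiffAt_symm _ (f₀' := L) hq ?_ hPz).contDiffWithinAt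
    dsimp only at hL
    rw [hL]
    exact (hPz.differentiableAt (by simp)).hasFDerivAt

end Straightening

section Local

variable {E F : Type*} [NormedAddCommGroup E] [NormedSpace ℝ E] [FiniteDimensional ℝ E]
  [MeasurableSpace F]

/-- Lindelöf: countably many of the local neighborhoods already cover `A`. Measurability plays no
role, as null sets are meant for the outer measure. -/
theorem measure_image_null_of_locally_null (μ : Measure F) {f : E → F} {A : Set E}
    (h : ∀ x ∈ A, ∃ t ∈ 𝓝[A] x, μ (f '' t) = 0) : μ (f '' A) = 0 := by
  have : SecondCountableTopology E :=
    have : ProperSpace E := FiniteDimensional.proper ℝ E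
    inferInstance
  choose! t ht hμ using h
  obtain ⟨s, hsA, hs, hcov⟩ := TopologicalSpace.countable_cover_nhdsWithin ht
  refine measure_mono_null (image_mono hcov) ?_
  rw [image_iUnion₂]
  exact (measure_biUnion_null_iff hs).2 fun x hx => hμ x (hsA hx)

end Local

section Flat

theorem one_add_natCast_le_infty (i : ℕ) : (1 : ℕ∞ω) + i ≤ ∞ :=
  mod_cast WithTop.coe_le_coe.2 (le_top (a := ((1 + i : ℕ) : ℕ∞)))

variable {E F : Type*} [NormedAddCommGroup E] [NormedSpace ℝ E]
  [NormedAddCommGroup F] [NormedSpace ℝ F]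

/-- Taylor's estimate at a point where the first `k` derivatives vanish. -/
theorem norm_sub_le_of_iteratedFDeriv_eq_zero {f : E → F} {B : Set E} (hB : Convex ℝ B)
    (hf : ∀ z ∈ B, ContDiffAt ℝ ∞ f z) {k : ℕ} {M : ℝ}
    (hM : ∀ z ∈ B, ‖iteratedFDeriv ℝ (k + 1) f z‖ ≤ M) {x : E} (hx : x ∈ B)
    (hx0 : ∀ i, 1 ≤ i → i ≤ k → iteratedFDeriv ℝ i f x = 0) {y : E} (hy : y ∈ B) :
    ‖f y - f x‖ ≤ M * ‖y - x‖ ^ (k + 1) := by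
  have hM0 : 0 ≤ M := (norm_nonneg _).trans (hM x hx)
  have hseg : ∀ y ∈ B, ∀ z ∈ segment ℝ x y, z ∈ B ∧ ‖z - x‖ ≤ ‖y - x‖ := by
    intro y hy z hz
    refine ⟨hB.segment_subset hx hy hz, ?_⟩
    rw [segment_eq_image'] at hz
    obtain ⟨t, ht, rfl⟩ := hz
    simp only [add_sub_cancel_left, norm_smul, Real.norm_eq_abs, abs_of_nonneg ht.1]
    exact mul_le_of_le_one_left (norm_nonneg _) ht.2
  -- Each use of the mean value inequality on the segment lowers the order by one and gains a factor
  -- `‖y - x‖`. It stops at order one, since `f x` itself need not vanish; the last step bounds `f y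
  -- - f x`.
  have key : ∀ j ≤ k, ∀ y ∈ B, ‖iteratedFDeriv ℝ (k + 1 - j) f y‖ ≤ M * ‖y - x‖ ^ j := by
    intro j
    induction j with
    | zero => intro _ y hy; simpa using hM y hy
    | succ j ih =>
      intro hj y hy
      have h1 : k + 1 - (j + 1) + 1 = k + 1 - j := by omega
      have h2 := (convex_segment x y).norm_image_sub_le_of_norm_fderiv_le (𝕜 := ℝ)
        (f := iteratedFDeriv ℝ (k + 1 - (j + 1)) f) (C := M * ‖y - x‖ ^ j)
        (fun z hz => ((hf z (hseg y hy z hz).1).iteratedFDeriv_right (m := 1)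
          (one_add_natCast_le_infty _)).differentiableAt (by simp))
        (fun z hz => by
          rw [norm_fderiv_iteratedFDeriv, h1]
          refine (ih (by omega) z (hseg y hy z hz).1).trans ?_
          gcongr
          exact (hseg y hy z hz).2)
        (left_mem_segment ℝ x y) (right_mem_segment ℝ x y)
      rw [hx0 _ (by omega) (by omega), sub_zero] at h2
      rwa [pow_succ, ← mul_assoc]
  have h2 := (convex_segment x y).norm_image_sub_le_of_norm_fderiv_le (𝕜 := ℝ)
    (f := f) (C := M * ‖y - x‖ ^ k)
    (fun z hz => (hf z (hseg y hy z hz).1).differentiableAt (by simp))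
    (fun z hz => by
      have := key k le_rfl z (hseg y hy z hz).1
      rw [show k + 1 - k = 1 by omega, norm_iteratedFDeriv_one] at this
      refine this.trans ?_
      gcongr
      exact (hseg y hy z hz).2)
    (left_mem_segment ℝ x y) (right_mem_segment ℝ x y)
  rwa [pow_succ, ← mul_assoc]

variable [FiniteDimensional ℝ E] [FiniteDimensional ℝ F] [MeasurableSpace F] [BorelSpace F]

/-- With `k` the dimension of `E`, Taylor's estimate makes `f` locally Hölder of exponent `k + 1` on
the flat set. The image therefore has Hausdorff dimension at most `k / (k + 1) < 1`, which is below
the dimension of the nontrivial space `F`. -/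
theorem measure_image_flat_null [Nontrivial F] (μ : Measure F) [μ.IsAddHaarMeasure]
    {f : E → F} {U : Set E} (hU : IsOpen U) (hf : ContDiffOn ℝ ∞ f U) :
    μ (f '' {x ∈ U | ∀ i, 1 ≤ i → i ≤ finrank ℝ E → iteratedFDeriv ℝ i f x = 0}) = 0 := by
  set k := finrank ℝ E with hk
  set A := {x ∈ U | ∀ i, 1 ≤ i → i ≤ k → iteratedFDeriv ℝ i f x = 0} with hA
  have : ProperSpace E := FiniteDimensional.proper ℝ E
  have : ProperSpace F := FiniteDimensional.proper ℝ F
  have hdim : dimH (f '' A) ≤ dimH A / ((k + 1 : NNReal) : ENNReal) := by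
    refine dimH_image_le_of_locally_holder_on (by positivity) fun x hx => ?_
    have hc : ContinuousAt (iteratedFDeriv ℝ (k + 1) f) x :=
      ((hf.contDiffAt (hU.mem_nhds hx.1)).iteratedFDeriv_right (m := 0)
        (by norm_cast; simp)).continuousAt
    have hev : ∀ᶠ z in 𝓝 x, z ∈ U ∧ ‖iteratedFDeriv ℝ (k + 1) f z‖ <
        ‖iteratedFDeriv ℝ (k + 1) f x‖ + 1 :=
      (show ∀ᶠ z in 𝓝 x, z ∈ U from hU.mem_nhds hx.1).and (hc.norm.eventually_lt_const (by simp))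
    obtain ⟨r, hr, hball⟩ := Metric.eventually_nhds_iff_ball.1 hev
    refine ⟨(‖iteratedFDeriv ℝ (k + 1) f x‖ + 1).toNNReal, A ∩ Metric.ball x r,
      inter_mem_nhdsWithin _ (Metric.ball_mem_nhds x hr), ?_⟩
    intro y hy z hz
    have h := norm_sub_le_of_iteratedFDeriv_eq_zero (convex_ball x r)
      (fun z hz => hf.contDiffAt (hU.mem_nhds (hball z hz).1))
      (fun z hz => (hball z hz).2.le) hy.2 hy.1.2 hz.2
    rw [edist_comm, edist_comm y z, edist_dist, edist_dist, dist_eq_norm, dist_eq_norm]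
    refine (ENNReal.ofReal_le_ofReal h).trans ?_
    rw [ENNReal.ofReal_mul (by positivity), ENNReal.ofReal_pow (norm_nonneg _)]
    refine le_of_eq ?_
    congr 1
    rw [← ENNReal.rpow_natCast]
    simp
  have hlt : dimH (f '' A) < ((finrank ℝ F : NNReal) : ENNReal) := by
    have h1 : dimH A ≤ (k : ENNReal) := by
      have := dimH_mono (subset_univ A)
      rwa [Real.dimH_univ_eq_finrank] at this
    have h2 : dimH A / ((k + 1 : NNReal) : ENNReal) < 1 := by
      rw [ENNReal.div_lt_iff (by simp) (by simp), one_mul]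
      refine h1.trans_lt ?_
      exact_mod_cast Nat.lt_succ_self k
    have h3 : (1 : ENNReal) ≤ ((finrank ℝ F : NNReal) : ENNReal) := by
      exact_mod_cast (finrank_pos (R := ℝ) (M := F))
    exact (hdim.trans_lt h2).trans_le h3
  refine measure_zero_of_dimH_lt (d := (finrank ℝ F : NNReal)) ?_ hlt
  have := isAddHaarMeasure_hausdorffMeasure (E := F)
  simpa using Measure.absolutelyContinuous_isAddHaarMeasure μ
    (Measure.hausdorffMeasure (finrank ℝ F : ℝ) : Measure F)

end Flat

section Slices

variable {E F C : Type*} [NormedAddCommGroup E] [NormedSpace ℝ E]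
  [NormedAddCommGroup F] [NormedSpace ℝ F] [NormedAddCommGroup C] [NormedSpace ℝ C]

/-- The differential of a local section of coordinates in which `w` is a projection. -/
theorem fderiv_comp_fderiv_symm_of_straightened {K : Type*} [NormedAddCommGroup K]
    [NormedSpace ℝ K] {w : E → C} {e : OpenPartialHomeomorph E (C × K)}
    (hew : ∀ z, (e z).1 = w z) (he : ContDiffOn ℝ ∞ e.symm e.target)
    {q : C × K} (hq : q ∈ e.target) (hw : DifferentiableAt ℝ w (e.symm q)) :
    fderiv ℝ w (e.symm q) ∘L fderiv ℝ e.symm q = ContinuousLinearMap.fst ℝ C K := by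
  have hd : DifferentiableAt ℝ e.symm q :=
    (he.contDiffAt (e.open_target.mem_nhds hq)).differentiableAt (by simp)
  rw [← fderiv_comp q hw hd]
  have : w ∘ e.symm =ᶠ[𝓝 q] Prod.fst := by
    filter_upwards [e.open_target.mem_nhds hq] with p hp
    rw [comp_apply, ← hew, e.right_inv hp]
  rw [this.fderiv_eq, fderiv_fst]

theorem finrank_ker_lt_of_surjective [FiniteDimensional ℝ E] {L : E →L[ℝ] ℝ}
    (hL : Surjective L) : finrank ℝ L.ker < finrank ℝ E := by
  have h := LinearMap.finrank_range_add_finrank_ker (L : E →ₗ[ℝ] ℝ)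
  rw [LinearMap.range_eq_top.2 hL, finrank_top, finrank_self] at h
  omega

theorem surjective_of_apply_ne_zero {L : E →L[ℝ] ℝ} {v : E} (h : L v ≠ 0) : Surjective L := by
  intro r
  exact ⟨(r / L v) • v, by simp [h]⟩

end Slices

/-- Sard's theorem for maps from `E`: critical values form a null set. -/
def SardFor (E : Type u) [NormedAddCommGroup E] [NormedSpace ℝ E] : Prop :=
  ∀ (F : Type v) [NormedAddCommGroup F] [NormedSpace ℝ F] [FiniteDimensional ℝ F]
    [MeasurableSpace F] [BorelSpace F] (μ : Measure F) [μ.IsAddHaarMeasure] (f : E → F)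
    (U : Set E), IsOpen U → ContDiffOn ℝ ∞ f U →
    μ (f '' {x ∈ U | ¬ Surjective (fderiv ℝ f x)}) = 0

section Induction

variable {E : Type u} [NormedAddCommGroup E] [NormedSpace ℝ E] [FiniteDimensional ℝ E]
  {F : Type v} [NormedAddCommGroup F] [NormedSpace ℝ F] [FiniteDimensional ℝ F]
  [MeasurableSpace F] [BorelSpace F]

/-- Critical points of rank zero on a smooth hypersurface `w = 0`. -/
theorem exists_nhdsWithin_image_null_of_fderiv_ne_zero [Nontrivial F]
    (ih : ∀ (K : Type u) [NormedAddCommGroup K] [NormedSpace ℝ K] [FiniteDimensional ℝ K],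
      finrank ℝ K < finrank ℝ E → SardFor.{u, v} K)
    (μ : Measure F) [μ.IsAddHaarMeasure] {f : E → F} {U : Set E} (hU : IsOpen U)
    (hf : ContDiffOn ℝ ∞ f U) {G : Type*} [NormedAddCommGroup G] [NormedSpace ℝ G] {w : E → G}
    (hw : ContDiffOn ℝ ∞ w U) {A : Set E} (hA : ∀ z ∈ A, fderiv ℝ f z = 0 ∧ w z = 0)
    {x : E} (hx : x ∈ U) (hwx : fderiv ℝ w x ≠ 0) :
    ∃ t ∈ 𝓝[A] x, μ (f '' t) = 0 := by
  obtain ⟨v, hv⟩ : ∃ v, fderiv ℝ w x v ≠ 0 := by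
    by_contra! h
    exact hwx (ContinuousLinearMap.ext h)
  obtain ⟨l, hl⟩ := SeparatingDual.exists_ne_zero (R := ℝ) hv
  have hlw : ContDiffOn ℝ ∞ (l ∘ w) U := l.contDiff.comp_contDiffOn hw
  have hd : fderiv ℝ (l ∘ w) x = l ∘L fderiv ℝ w x := by
    rw [fderiv_comp x l.differentiableAt
      ((hw.contDiffAt (hU.mem_nhds hx)).differentiableAt (by simp)), l.fderiv]
  have hs : Surjective (fderiv ℝ (l ∘ w) x) :=
    surjective_of_apply_ne_zero (v := v) (by simpa [hd] using hl)
  obtain ⟨K, hK, e, hxe, heU, hew, he⟩ := exists_straightening hU hlw hx hs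
  refine ⟨A ∩ e.source, inter_mem_nhdsWithin _ (e.open_source.mem_nhds hxe), ?_⟩
  -- The slice over `0` parametrizes the part of the hypersurface `l ∘ w = 0` in `e.source`, hence
  -- covers `A` there. Its dimension is one lower, and `f` restricted to it still has zero
  -- differential at the points of `A`.
  have hι : ContDiff ℝ ∞ (fun y : K => ((0 : ℝ), y)) := by fun_prop
  have hV : IsOpen ((fun y : K => ((0 : ℝ), y)) ⁻¹' e.target) :=
    e.open_target.preimage hι.continuous
  have hg : ContDiffOn ℝ ∞ (f ∘ e.symm ∘ fun y : K => ((0 : ℝ), y))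
      ((fun y : K => ((0 : ℝ), y)) ⁻¹' e.target) := by
    refine hf.comp (he.comp hι.contDiffOn (fun y hy => hy)) fun y hy => heU (e.map_target hy)
  refine measure_mono_null ?_ (ih K (hK ▸ finrank_ker_lt_of_surjective hs) F μ _ _ hV hg)
  rintro _ ⟨z, ⟨hzA, hz⟩, rfl⟩
  have hez : e z = (0, (e z).2) := Prod.ext (by simp [hew, (hA z hzA).2]) rfl
  have hzt : (0, (e z).2) ∈ e.target := hez ▸ e.map_source hz
  have hsymm : e.symm (0, (e z).2) = z := by rw [← hez, e.left_inv hz]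
  refine ⟨(e z).2, ⟨hzt, ?_⟩, by simp [hsymm]⟩
  have hσ : DifferentiableAt ℝ (e.symm ∘ fun y : K => ((0 : ℝ), y)) (e z).2 :=
    ((he.comp hι.contDiffOn (fun y hy => hy)).contDiffAt
      (hV.mem_nhds hzt)).differentiableAt (by simp)
  have hfz : DifferentiableAt ℝ f ((e.symm ∘ fun y : K => ((0 : ℝ), y)) (e z).2) := by
    rw [comp_apply, hsymm]
    exact (hf.contDiffAt (hU.mem_nhds (heU hz))).differentiableAt (by simp)
  rw [fderiv_comp _ hfz hσ, comp_apply, hsymm, (hA z hzA).1]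
  intro hsur
  obtain ⟨y, hy⟩ := exists_ne (0 : F)
  obtain ⟨k, hk⟩ := hsur y
  exact hy (by simpa using hk.symm)

/-- Critical points of positive rank. -/
theorem exists_nhdsWithin_image_null_of_rank_pos
    (ih : ∀ (K : Type u) [NormedAddCommGroup K] [NormedSpace ℝ K] [FiniteDimensional ℝ K],
      finrank ℝ K < finrank ℝ E → SardFor.{u, v} K)
    (μ : Measure F) [μ.IsAddHaarMeasure] {f : E → F} {U : Set E} (hU : IsOpen U)
    (hf : ContDiffOn ℝ ∞ f U) {x : E} (hx : x ∈ U) (hfx : fderiv ℝ f x ≠ 0) :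
    ∃ t ∈ 𝓝[{x ∈ U | ¬ Surjective (fderiv ℝ f x)}] x, μ (f '' t) = 0 := by
  obtain ⟨v, hv⟩ : ∃ v, fderiv ℝ f x v ≠ 0 := by
    by_contra! h
    exact hfx (ContinuousLinearMap.ext h)
  obtain ⟨l, hl⟩ := SeparatingDual.exists_ne_zero (R := ℝ) hv
  have hdiff : ∀ z ∈ U, DifferentiableAt ℝ f z := fun z hz =>
    (hf.contDiffAt (hU.mem_nhds hz)).differentiableAt (by simp)
  have hlf : ContDiffOn ℝ ∞ (l ∘ f) U := l.contDiff.comp_contDiffOn hf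
  have hd : fderiv ℝ (l ∘ f) x = l ∘L fderiv ℝ f x := by
    rw [fderiv_comp x l.differentiableAt (hdiff x hx), l.fderiv]
  have hs : Surjective (fderiv ℝ (l ∘ f) x) :=
    surjective_of_apply_ne_zero (v := v) (by simpa [hd] using hl)
  obtain ⟨R, hR⟩ := l.exists_rightInverse_of_surjective
    (LinearMap.range_eq_top.2 (surjective_of_apply_ne_zero hl))
  obtain ⟨Θ, hΘ⟩ : ∃ Θ : F ≃L[ℝ] ℝ × l.ker, ∀ y, (Θ y).1 = l y :=
    ⟨ContinuousLinearEquiv.equivOfRightInverse l R (fun y => DFunLike.congr_fun hR y),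
      fun y => ContinuousLinearEquiv.fst_equivOfRightInverse _ _ _ _⟩
  obtain ⟨K, hK, e, hxe, heU, hew, he⟩ := exists_straightening hU hlf hx hs
  have : ProperSpace E := FiniteDimensional.proper ℝ E
  have : ProperSpace F := FiniteDimensional.proper ℝ F
  obtain ⟨T, hT, hTe, hTc⟩ := local_compact_nhds (e.open_source.mem_nhds hxe)
  set Crit := {x ∈ U | ¬ Surjective (fderiv ℝ f x)} with hCrit
  refine ⟨Crit ∩ T, inter_mem_nhdsWithin _ hT, ?_⟩
  have hTU : T ⊆ U := hTe.trans heU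
  -- Compactness is needed to make the image measurable, as Fubini requires.
  have hcomp : IsCompact (Crit ∩ T) := by
    have h1 : ContinuousOn (fderiv ℝ f) T :=
      (hf.continuousOn_fderiv_of_isOpen hU (by simp)).mono hTU
    have h2 := h1.preimage_isClosed_of_isClosed hTc.isClosed
      (isOpen_setOf_surjective_clm (E := E) (F := F)).isClosed_compl
    convert hTc.of_isClosed_subset h2 inter_subset_left using 1
    ext z
    simp only [hCrit, mem_inter_iff, mem_ofPred_eq, mem_preimage, mem_compl_iff]
    exact ⟨fun h => ⟨h.2, h.1.2⟩, fun h => ⟨⟨hTU h.1, h.2⟩, h.1⟩⟩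
  set D : Set (ℝ × l.ker) := (Θ ∘ f) '' (Crit ∩ T) with hD
  have hDm : MeasurableSet D :=
    (hcomp.image_of_continuousOn (Θ.continuous.comp_continuousOn
      (hf.continuousOn.mono fun z hz => hz.1.1))).isClosed.measurableSet
  let ν : Measure l.ker := Measure.addHaar
  -- In the coordinates `e` and `Θ`, the map `f` preserves the first coordinate. A critical point of
  -- `f` is then critical for the map between the slices over the same `τ`, and induction makes
  -- every slice of `D` null.
  have hnull : (volume.prod ν) D = 0 := by
    refine (Measure.measure_prod_null hDm).2 (Filter.Eventually.of_forall fun τ => ?_)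
    have hι : ContDiff ℝ ∞ (fun y : K => (τ, y)) := by fun_prop
    have hV : IsOpen ((fun y : K => (τ, y)) ⁻¹' e.target) :=
      e.open_target.preimage hι.continuous
    have hΘf : ContDiffOn ℝ ∞ (fun z => (Θ (f z)).2) U :=
      (contDiff_snd.comp Θ.contDiff).comp_contDiffOn hf
    have hg : ContDiffOn ℝ ∞ ((fun z => (Θ (f z)).2) ∘ e.symm ∘ fun y : K => (τ, y))
        ((fun y : K => (τ, y)) ⁻¹' e.target) :=
      hΘf.comp (he.comp hι.contDiffOn (fun y hy => hy)) fun y hy => heU (e.map_target hy)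
    refine measure_mono_null ?_ (ih K (hK ▸ finrank_ker_lt_of_surjective hs) l.ker ν _ _ hV hg)
    rintro k ⟨z, ⟨hzC, hzT⟩, hz⟩
    have hzs := hTe hzT
    have hez : e z = (τ, (e z).2) := by
      refine Prod.ext ?_ rfl
      rw [hew, comp_apply, ← hΘ]
      exact congrArg Prod.fst hz
    have hzt : (τ, (e z).2) ∈ e.target := hez ▸ e.map_source hzs
    have hsymm : e.symm (τ, (e z).2) = z := by rw [← hez, e.left_inv hzs]
    refine ⟨(e z).2, ⟨hzt, fun hsur => hzC.2 ?_⟩, ?_⟩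
    swap
    · simp only [comp_apply, hsymm]
      exact congrArg Prod.snd hz
    have hσ : DifferentiableAt ℝ e.symm (τ, (e z).2) :=
      (he.contDiffAt (e.open_target.mem_nhds hzt)).differentiableAt (by simp)
    have hι' : HasFDerivAt (fun y : K => (τ, y)) (ContinuousLinearMap.inr ℝ ℝ K) (e z).2 :=
      hasFDerivAt_prodMk_right τ _
    have hfz := hdiff z hzC.1
    have hdg : HasFDerivAt ((fun z => (Θ (f z)).2) ∘ e.symm ∘ fun y : K => (τ, y))
        ((((ContinuousLinearMap.snd ℝ ℝ l.ker) ∘L (Θ : F →L[ℝ] ℝ × l.ker)) ∘L fderiv ℝ f z) ∘L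
          (fderiv ℝ e.symm (τ, (e z).2) ∘L ContinuousLinearMap.inr ℝ ℝ K)) (e z).2 := by
      have h1 : HasFDerivAt (e.symm ∘ fun y : K => (τ, y)) _ (e z).2 :=
        HasFDerivAt.comp (e z).2 hσ.hasFDerivAt hι'
      refine HasFDerivAt.comp (e z).2 ?_ h1
      rw [comp_apply, hsymm]
      exact ((ContinuousLinearMap.snd ℝ ℝ l.ker) ∘L
        (Θ : F →L[ℝ] ℝ × l.ker)).hasFDerivAt.comp z hfz.hasFDerivAt
    rw [hdg.fderiv] at hsur
    have hfst := fderiv_comp_fderiv_symm_of_straightened (w := l ∘ f) hew he hzt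
      (by
        rw [hsymm]
        exact (hlf.contDiffAt (hU.mem_nhds hzC.1)).differentiableAt (by simp))
    rw [hsymm, fderiv_comp z l.differentiableAt hfz, l.fderiv] at hfst
    intro y
    set c := (Θ y).1
    -- The differential is block triangular: `c` settles the first coordinate of `y`, and `η`,
    -- moving inside the slice, corrects the second.
    obtain ⟨η, hη⟩ := hsur ((Θ y).2 - (Θ (fderiv ℝ f z (fderiv ℝ e.symm (τ, (e z).2) (c, 0)))).2)
    refine ⟨fderiv ℝ e.symm (τ, (e z).2) (c, η), Θ.injective (Prod.ext ?_ ?_)⟩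
    · rw [hΘ]
      exact DFunLike.congr_fun hfst (c, η)
    · have : ((c, η) : ℝ × K) = (c, 0) + (0, η) := by simp
      rw [this, map_add, map_add, map_add, Prod.snd_add]
      simp only [ContinuousLinearMap.comp_apply, ContinuousLinearMap.inr_apply,
        ContinuousLinearMap.coe_snd', ContinuousLinearEquiv.coe_coe] at hη
      rw [hη]
      abel
  have hac : μ.map Θ ≪ volume.prod ν := by
    have := Θ.isAddHaarMeasure_map μ
    exact Measure.absolutelyContinuous_isAddHaarMeasure _ _
  have := hac hnull
  rw [Measure.map_apply Θ.continuous.measurable hDm] at this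
  refine measure_mono_null ?_ this
  rintro _ ⟨z, hz, rfl⟩
  exact ⟨z, hz, rfl⟩

/-- A critical point is flat up to the order of the dimension, or has nonzero differential, or has a
first nonvanishing derivative of some higher order. In the last case the derivative one order below
vanishes there with nonzero differential, so it cuts out a hypersurface containing such points. -/
theorem sardFor_of_finrank_lt
    (ih : ∀ (K : Type u) [NormedAddCommGroup K] [NormedSpace ℝ K] [FiniteDimensional ℝ K],
      finrank ℝ K < finrank ℝ E → SardFor.{u, v} K) : SardFor.{u, v} E := by
  intro F _ _ _ _ _ μ _ f U hU hf
  rcases subsingleton_or_nontrivial F with hF | hF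
  · have : {x ∈ U | ¬ Surjective (fderiv ℝ f x)} = ∅ := by
      refine eq_empty_of_forall_notMem fun x hx => hx.2 fun y => ⟨0, Subsingleton.elim _ _⟩
    simp [this]
  set Crit := {x ∈ U | ¬ Surjective (fderiv ℝ f x)} with hCrit
  set Flat := {x ∈ U | ∀ i, 1 ≤ i → i ≤ finrank ℝ E → iteratedFDeriv ℝ i f x = 0} with hFlat
  have hcover : Crit ⊆ Flat ∪ ({x ∈ Crit | fderiv ℝ f x ≠ 0} ∪ ⋃ i : ℕ,
      {x ∈ U | (fderiv ℝ f x = 0 ∧ iteratedFDeriv ℝ i f x = 0) ∧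
        fderiv ℝ (iteratedFDeriv ℝ i f) x ≠ 0}) := by
    intro x hx
    by_cases h0 : fderiv ℝ f x = 0
    swap
    · exact Or.inr (Or.inl ⟨hx, h0⟩)
    by_cases hfl : x ∈ Flat
    · exact Or.inl hfl
    refine Or.inr (Or.inr (mem_iUnion.2 ?_))
    have hex : ∃ i, iteratedFDeriv ℝ (i + 1) f x ≠ 0 := by
      by_contra! h
      refine hfl ⟨hx.1, fun i hi _ => ?_⟩
      obtain ⟨j, rfl⟩ := Nat.exists_eq_add_of_le' hi
      exact h j
    classical
    have hfind := Nat.find_spec hex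
    -- Index `i` stands for order `i + 1`; index zero is excluded because the first derivative
    -- vanishes.
    have h1 : Nat.find hex ≠ 0 := by
      intro h
      rw [h, ← norm_ne_zero_iff, zero_add, norm_iteratedFDeriv_one] at hfind
      exact hfind (by simp [h0])
    obtain ⟨j, hj⟩ := Nat.exists_eq_succ_of_ne_zero h1
    have hmin : iteratedFDeriv ℝ (j + 1) f x = 0 := by
      have := Nat.find_min hex (m := j) (by omega)
      simpa using this
    rw [hj] at hfind
    refine ⟨j + 1, hx.1, ⟨h0, hmin⟩, ?_⟩
    refine fun h => hfind (norm_eq_zero.1 ?_)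
    rw [← norm_fderiv_iteratedFDeriv, h]
    exact ContinuousLinearMap.opNorm_zero
  refine measure_mono_null (image_mono hcover) ?_
  rw [image_union, image_union, image_iUnion, measure_union_null_iff, measure_union_null_iff,
    measure_iUnion_null_iff]
  refine ⟨measure_image_flat_null μ hU hf, ?_, fun i => ?_⟩
  · refine measure_image_null_of_locally_null μ fun x hx => ?_
    obtain ⟨t, ht, h⟩ := exists_nhdsWithin_image_null_of_rank_pos ih μ hU hf hx.1.1 hx.2
    exact ⟨t, nhdsWithin_mono x (fun z hz => hz.1) ht, h⟩
  · refine measure_image_null_of_locally_null μ fun x hx => ?_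
    have hw : ContDiffOn ℝ ∞ (iteratedFDeriv ℝ i f) U := fun z hz =>
      ((hf.contDiffAt (hU.mem_nhds hz)).iteratedFDeriv_right (m := ∞)
        (by norm_cast)).contDiffWithinAt
    exact exists_nhdsWithin_image_null_of_fderiv_ne_zero ih μ hU hf hw
      (fun z hz => hz.2.1) hx.1 hx.2.2

end Induction

/-- **Sard's theorem**: the critical values of a smooth map between finite-dimensional spaces form
a null set. -/
theorem sardFor (E : Type u) [NormedAddCommGroup E] [NormedSpace ℝ E] [FiniteDimensional ℝ E] :
    SardFor.{u, v} E := by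
  suffices H : ∀ (n : ℕ) (E : Type u) [NormedAddCommGroup E] [NormedSpace ℝ E]
      [FiniteDimensional ℝ E], finrank ℝ E = n → SardFor.{u, v} E from H _ E rfl
  intro n
  induction n using Nat.strong_induction_on with
  | _ n ih =>
    intro E _ _ _ hE
    exact sardFor_of_finrank_lt fun K _ _ _ hK => ih _ (hE ▸ hK) K rfl

/-- Parametric transversality for a submersion: for almost every parameter, the partial map is a
submersion along its zero set. -/
theorem measure_not_surjective_fderiv_inr_null {S : Type u} {E : Type v} {C : Type*}
    [NormedAddCommGroup S] [NormedSpace ℝ S] [FiniteDimensional ℝ S] [MeasurableSpace S]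
    [BorelSpace S] [NormedAddCommGroup E] [NormedSpace ℝ E] [FiniteDimensional ℝ E]
    [NormedAddCommGroup C] [NormedSpace ℝ C] [FiniteDimensional ℝ C]
    (μ : Measure S) [μ.IsAddHaarMeasure] {g : S × E → C} {W : Set (S × E)} (hW : IsOpen W)
    (hg : ContDiffOn ℝ ∞ g W) (hsub : ∀ p ∈ W, g p = 0 → Surjective (fderiv ℝ g p)) :
    μ {s | ∃ x, (s, x) ∈ W ∧ g (s, x) = 0 ∧
      ¬ Surjective (fderiv ℝ g (s, x) ∘L ContinuousLinearMap.inr ℝ S E)} = 0 := by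
  set A := {p ∈ W | g p = 0 ∧ ¬ Surjective (fderiv ℝ g p ∘L ContinuousLinearMap.inr ℝ S E)}
    with hA
  have hfst : {s | ∃ x, (s, x) ∈ W ∧ g (s, x) = 0 ∧
      ¬ Surjective (fderiv ℝ g (s, x) ∘L ContinuousLinearMap.inr ℝ S E)} = Prod.fst '' A := by
    ext s
    constructor
    · rintro ⟨x, hx⟩
      exact ⟨(s, x), hx, rfl⟩
    · rintro ⟨⟨_, x⟩, hx, rfl⟩
      exact ⟨x, hx⟩
  rw [hfst]
  refine measure_image_null_of_locally_null μ fun p hp => ?_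
  obtain ⟨K, -, e, hpe, heW, heg, he⟩ := exists_straightening hW hg hp.1 (hsub p hp.1 hp.2.1)
  refine ⟨A ∩ e.source, inter_mem_nhdsWithin _ (e.open_source.mem_nhds hpe), ?_⟩
  have hι : ContDiff ℝ ∞ (fun y : K => ((0 : C), y)) := by fun_prop
  have hV : IsOpen ((fun y : K => ((0 : C), y)) ⁻¹' e.target) :=
    e.open_target.preimage hι.continuous
  have hφ : ContDiffOn ℝ ∞ (Prod.fst ∘ e.symm ∘ fun y : K => ((0 : C), y))
      ((fun y : K => ((0 : C), y)) ⁻¹' e.target) :=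
    contDiff_fst.comp_contDiffOn (he.comp hι.contDiffOn (fun y hy => hy))
  -- Sard is applied to the projection of the zero set `g = 0`, parametrized by `K`, to `S`. It
  -- suffices that a parameter `s` is bad at a point only if this projection is critical there.
  refine measure_mono_null ?_ (sardFor K S μ _ _ hV hφ)
  rintro _ ⟨q, ⟨hqA, hqe⟩, rfl⟩
  have heq : e q = (0, (e q).2) := Prod.ext (by simp [heg, hqA.2.1]) rfl
  have hqt : (0, (e q).2) ∈ e.target := heq ▸ e.map_source hqe
  have hsymm : e.symm (0, (e q).2) = q := by rw [← heq, e.left_inv hqe]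
  refine ⟨(e q).2, ⟨hqt, fun hsur => hqA.2.2 fun c => ?_⟩, by simp [hsymm]⟩
  have hσ : DifferentiableAt ℝ e.symm (0, (e q).2) :=
    (he.contDiffAt (e.open_target.mem_nhds hqt)).differentiableAt (by simp)
  have hdφ : HasFDerivAt (Prod.fst ∘ e.symm ∘ fun y : K => ((0 : C), y))
      (ContinuousLinearMap.fst ℝ S E ∘L
        (fderiv ℝ e.symm (0, (e q).2) ∘L ContinuousLinearMap.inr ℝ C K)) (e q).2 :=
    hasFDerivAt_fst.comp (e q).2
      (HasFDerivAt.comp (e q).2 hσ.hasFDerivAt (hasFDerivAt_prodMk_right _ _))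
  rw [hdφ.fderiv] at hsur
  have hfst := fderiv_comp_fderiv_symm_of_straightened heg he hqt
    (by rw [hsymm]; exact (hg.contDiffAt (hW.mem_nhds hqA.1)).differentiableAt (by simp))
  rw [hsymm] at hfst
  set σ := fderiv ℝ e.symm (0, (e q).2)
  -- The vector `σ (c, 0)` is a lift of `c`. Subtracting `σ (0, η)`, which is tangent to the zero
  -- set, kills its `S`-component without changing its image.
  obtain ⟨η, hη⟩ := hsur (σ (c, 0)).1
  refine ⟨(σ (c, -η)).2, ?_⟩
  have h1 : (σ (c, -η)).1 = 0 := by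
    have : ((c, -η) : C × K) = (c, 0) - (0, η) := by simp
    rw [this, map_sub, Prod.fst_sub, sub_eq_zero, ← hη]
    rfl
  have h2 : fderiv ℝ g q (σ (c, -η)) = c := DFunLike.congr_fun hfst (c, -η)
  have h3 : ((0 : S), (σ (c, -η)).2) = σ (c, -η) := Prod.ext h1.symm rfl
  rw [ContinuousLinearMap.comp_apply, ContinuousLinearMap.inr_apply, h3, h2]

end Sard

/-! ### Differentials of charts and of maps written in charts -/

section ChartDerivatives

open Set Function

variable {E E' E'' H H' H'' : Type*}
  [NormedAddCommGroup E] [NormedSpace ℝ E] [NormedAddCommGroup E'] [NormedSpace ℝ E']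
  [NormedAddCommGroup E''] [NormedSpace ℝ E'']
  [TopologicalSpace H] [TopologicalSpace H'] [TopologicalSpace H'']
  {I : ModelWithCorners ℝ E H} {J : ModelWithCorners ℝ E' H'} {L : ModelWithCorners ℝ E'' H''}
  {X Y V : Type*} [TopologicalSpace X] [ChartedSpace H X] [TopologicalSpace Y] [ChartedSpace H' Y]
  [TopologicalSpace V] [ChartedSpace H'' V]

/-- The manifold derivative, seen as a linear map between the model spaces. -/
noncomputable def modelDeriv (I : ModelWithCorners ℝ E H) (J : ModelWithCorners ℝ E' H')
    (f : X → Y) (x : X) : E →L[ℝ] E' :=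
  mfderiv I J f x

theorem modelDeriv_comp {g : Y → V} {f : X → Y} (x : X) (hg : MDifferentiableAt J L g (f x))
    (hf : MDifferentiableAt I J f x) :
    modelDeriv I L (g ∘ f) x = modelDeriv J L g (f x) ∘L modelDeriv I J f x :=
  mfderiv_comp x hg hf

theorem modelDeriv_congr {f g : X → Y} {x : X} (h : f =ᶠ[𝓝 x] g) :
    modelDeriv I J f x = modelDeriv I J g x :=
  h.mfderiv_eq

theorem modelDeriv_eq_fderiv {f : E → E'} {x : E} :
    modelDeriv 𝓘(ℝ, E) 𝓘(ℝ, E') f x = fderiv ℝ f x :=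
  mfderiv_eq_fderiv

theorem mdifferentiableAt_extend {φ : OpenPartialHomeomorph X H}
    (hφ : φ ∈ IsManifold.maximalAtlas I ∞ X) {x : X} (hx : x ∈ φ.source) :
    MDifferentiableAt I 𝓘(ℝ, E) (φ.extend I) x :=
  (OpenPartialHomeomorph.contMDiffAt_extend hφ hx).mdifferentiableAt (by simp)

theorem contMDiffOn_extend_symm_target [I.Boundaryless] {φ : OpenPartialHomeomorph X H}
    (hφ : φ ∈ IsManifold.maximalAtlas I ∞ X) :
    ContMDiffOn 𝓘(ℝ, E) I ∞ (φ.extend I).symm (φ.extend I).target :=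
  (contMDiffOn_extend_symm hφ).mono (by rw [φ.extend_target'])

theorem mdifferentiableAt_extend_symm [I.Boundaryless] {φ : OpenPartialHomeomorph X H}
    (hφ : φ ∈ IsManifold.maximalAtlas I ∞ X) {x : X} (hx : x ∈ φ.source) :
    MDifferentiableAt 𝓘(ℝ, E) I (φ.extend I).symm (φ.extend I x) :=
  ((contMDiffOn_extend_symm_target hφ).contMDiffAt
    (φ.isOpen_extend_target.mem_nhds ((φ.extend I).map_source (by rwa [φ.extend_source])))
    ).mdifferentiableAt (by simp)

/-- The chart composed with its inverse is the identity on a neighborhood within `range I`, and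
derivatives within `range I` are unique. Boundary and corners are allowed, because this is also
applied to the charts of `Z`. -/
theorem surjective_modelDeriv_extend {φ : OpenPartialHomeomorph X H}
    (hφ : φ ∈ IsManifold.maximalAtlas I ∞ X) {x : X} (hx : x ∈ φ.source) :
    Surjective (modelDeriv I 𝓘(ℝ, E) (φ.extend I) x) := by
  set p := φ.extend I x with hp
  have hsymm : (φ.extend I).symm p = x := φ.extend_left_inv hx
  have hpt : p ∈ (φ.extend I).target := (φ.extend I).map_source (by rwa [φ.extend_source])
  have hpr : p ∈ range I := ⟨φ x, rfl⟩
  have hnhds : (φ.extend I).target ∈ 𝓝[range I] p := φ.extend_target_mem_nhdsWithin hx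
  have hd : MDifferentiableWithinAt 𝓘(ℝ, E) I (φ.extend I).symm (range I) p := by
    have h1 := (contMDiffOn_extend_symm hφ).mono
      (show (φ.extend I).target ⊆ I '' φ.target by rw [φ.extend_target']) p hpt
    exact (h1.mdifferentiableWithinAt (by simp)).mono_of_mem_nhdsWithin hnhds
  have hx' : (φ.extend I).symm p ∈ φ.source := by rwa [hsymm]
  obtain ⟨D, h2⟩ : ∃ D : E →L[ℝ] E, HasFDerivWithinAt (φ.extend I ∘ (φ.extend I).symm)
      (modelDeriv I 𝓘(ℝ, E) (φ.extend I) ((φ.extend I).symm p) ∘L D) (range I) p :=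
    ⟨mfderivWithin 𝓘(ℝ, E) I (φ.extend I).symm (range I) p,
      hasMFDerivWithinAt_iff_hasFDerivWithinAt.1
        ((mdifferentiableAt_extend hφ hx').hasMFDerivAt.comp_hasMFDerivWithinAt p
          hd.hasMFDerivWithinAt)⟩
  have h3 : HasFDerivWithinAt (φ.extend I ∘ (φ.extend I).symm) (ContinuousLinearMap.id ℝ E)
      (range I) p := by
    refine (hasFDerivWithinAt_id p (range I)).congr_of_eventuallyEq ?_
      ((φ.extend I).right_inv hpt)
    filter_upwards [hnhds] with q hq using (φ.extend I).right_inv hq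
  have h4 := (I.uniqueDiffOn p hpr).eq h2 h3
  have h5 : Surjective (modelDeriv I 𝓘(ℝ, E) (φ.extend I) ((φ.extend I).symm p)) :=
    fun v => ⟨_, DFunLike.congr_fun h4 v⟩
  rwa [hsymm] at h5

theorem bijective_modelDeriv_extend [FiniteDimensional ℝ E] {φ : OpenPartialHomeomorph X H}
    (hφ : φ ∈ IsManifold.maximalAtlas I ∞ X) {x : X} (hx : x ∈ φ.source) :
    Bijective (modelDeriv I 𝓘(ℝ, E) (φ.extend I) x) :=
  have h := surjective_modelDeriv_extend hφ hx
  ⟨(LinearMap.injective_iff_surjective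
    (f := (modelDeriv I 𝓘(ℝ, E) (φ.extend I) x).toLinearMap)).2 h, h⟩

theorem fderiv_writtenInCharts_comp [I.Boundaryless] {φ : OpenPartialHomeomorph X H}
    (hφ : φ ∈ IsManifold.maximalAtlas I ∞ X) {ψ : OpenPartialHomeomorph Y H'}
    (hψ : ψ ∈ IsManifold.maximalAtlas J ∞ Y) {f : X → Y} {x : X} (hf : MDifferentiableAt I J f x)
    (hx : x ∈ φ.source) (hfx : f x ∈ ψ.source) :
    fderiv ℝ (ψ.extend J ∘ f ∘ (φ.extend I).symm) (φ.extend I x) ∘L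
      modelDeriv I 𝓘(ℝ, E) (φ.extend I) x =
      modelDeriv J 𝓘(ℝ, E') (ψ.extend J) (f x) ∘L modelDeriv I J f x := by
  have hsymm : (φ.extend I).symm (φ.extend I x) = x := φ.extend_left_inv hx
  have hrep : MDifferentiableAt 𝓘(ℝ, E) 𝓘(ℝ, E') (ψ.extend J ∘ f ∘ (φ.extend I).symm)
      (φ.extend I x) := by
    have h1 : MDifferentiableAt 𝓘(ℝ, E) J (f ∘ (φ.extend I).symm) (φ.extend I x) :=
      MDifferentiableAt.comp _ (by rwa [hsymm]) (mdifferentiableAt_extend_symm hφ hx)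
    refine MDifferentiableAt.comp _ (mdifferentiableAt_extend hψ ?_) h1
    rwa [comp_apply, hsymm]
  have h2 : (ψ.extend J ∘ f ∘ (φ.extend I).symm) ∘ φ.extend I =ᶠ[𝓝 x] ψ.extend J ∘ f := by
    filter_upwards [φ.open_source.mem_nhds hx] with z hz
    simp only [comp_apply, φ.extend_left_inv hz]
  rw [← modelDeriv_eq_fderiv, ← modelDeriv_comp x hrep (mdifferentiableAt_extend hφ hx),
    modelDeriv_congr h2, modelDeriv_comp x (mdifferentiableAt_extend hψ hfx) hf]

theorem contDiffOn_writtenInCharts [I.Boundaryless] {φ : OpenPartialHomeomorph X H}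
    (hφ : φ ∈ IsManifold.maximalAtlas I ∞ X) {ψ : OpenPartialHomeomorph Y H'}
    (hψ : ψ ∈ IsManifold.maximalAtlas J ∞ Y) {f : X → Y} (hf : ContMDiff I J ∞ f) :
    ContDiffOn ℝ ∞ (ψ.extend J ∘ f ∘ (φ.extend I).symm)
      ((φ.extend I).target ∩ (f ∘ (φ.extend I).symm) ⁻¹' ψ.source) := by
  rw [← contMDiffOn_iff_contDiffOn]
  refine (OpenPartialHomeomorph.contMDiffOn_extend hψ).comp (t := ψ.source) ?_
    (fun q hq => hq.2)
  exact hf.comp_contMDiffOn ((contMDiffOn_extend_symm_target hφ).mono inter_subset_left)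

end ChartDerivatives

/-! ### Linear defining maps for the submanifold -/

section DefiningMap

open Set Function

universe v

variable {E F H H' G : Type*} {E' : Type v}
  [NormedAddCommGroup E] [NormedSpace ℝ E]
  [NormedAddCommGroup E'] [NormedSpace ℝ E']
  [NormedAddCommGroup F] [NormedSpace ℝ F]
  [TopologicalSpace H] [TopologicalSpace H'] [TopologicalSpace G]
  {I : ModelWithCorners ℝ E H} {J : ModelWithCorners ℝ E' H'} {K : ModelWithCorners ℝ F G}
  {X Y : Type*} [TopologicalSpace X] [ChartedSpace H X] [TopologicalSpace Y] [ChartedSpace H' Y]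
  {Z : Set Y} [ChartedSpace G Z]

theorem isTransversalAt_iff_modelDeriv {f : X → Y} {x : X} (hx : f x ∈ Z) :
    IsTransversalAt I J K Z f x ↔ (modelDeriv I J f x).range ⊔
      (modelDeriv K J (Subtype.val : Z → Y) ⟨f x, hx⟩).range = ⊤ :=
  ⟨fun h => h hx, fun h _ => h⟩

/-- On `N`, in the chart `ψ`, the submanifold `Z` is contained in the kernel of the linear
map `P`, and its tangent spaces are equal to this kernel. -/
structure IsDefiningMap (J : ModelWithCorners ℝ E' H') (K : ModelWithCorners ℝ F G) (Z : Set Y)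
    [ChartedSpace G Z] {C : Type*} [NormedAddCommGroup C] [NormedSpace ℝ C]
    (ψ : OpenPartialHomeomorph Y H') (P : E' →L[ℝ] C) (N : Set Y) : Prop where
  mem_maximalAtlas : ψ ∈ IsManifold.maximalAtlas J ∞ Y
  surjective : Surjective P
  isOpen : IsOpen N
  subset_source : N ⊆ ψ.source
  apply_eq_zero : ∀ y ∈ N, y ∈ Z → P (ψ.extend J y) = 0
  mem_range_iff : ∀ y ∈ N, ∀ (hy : y ∈ Z) (v : E'),
    v ∈ (modelDeriv K J (Subtype.val : Z → Y) ⟨y, hy⟩).range ↔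
      P (modelDeriv J 𝓘(ℝ, E') (ψ.extend J) y v) = 0

/-- `P` composed with the differential of `ψ` is onto with kernel the tangent space of `Z`. A
subspace spans together with this kernel exactly when its image under the composite is everything.
-/
theorem IsDefiningMap.isTransversalAt_iff [FiniteDimensional ℝ E'] [I.Boundaryless] {C : Type*}
    [NormedAddCommGroup C] [NormedSpace ℝ C] {ψ : OpenPartialHomeomorph Y H'} {P : E' →L[ℝ] C}
    {N : Set Y} (h : IsDefiningMap J K Z ψ P N) {φ : OpenPartialHomeomorph X H}
    (hφ : φ ∈ IsManifold.maximalAtlas I ∞ X) {f : X → Y} {x : X} (hf : MDifferentiableAt I J f x)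
    (hx : x ∈ φ.source) (hfN : f x ∈ N) (hfZ : f x ∈ Z) :
    IsTransversalAt I J K Z f x ↔
      Surjective (P ∘L fderiv ℝ (ψ.extend J ∘ f ∘ (φ.extend I).symm) (φ.extend I x)) := by
  have hψ := bijective_modelDeriv_extend h.mem_maximalAtlas (h.subset_source hfN)
  have hφ' := surjective_modelDeriv_extend hφ hx
  have key := fun v => DFunLike.congr_fun
    (fderiv_writtenInCharts_comp hφ h.mem_maximalAtlas hf hx (h.subset_source hfN)) v
  simp only [ContinuousLinearMap.comp_apply] at key
  have hmem := h.mem_range_iff (f x) hfN hfZ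
  rw [isTransversalAt_iff_modelDeriv hfZ]
  constructor
  · intro ht c
    obtain ⟨e, rfl⟩ := h.surjective c
    obtain ⟨y, rfl⟩ := hψ.2 e
    have hy : y ∈ (modelDeriv I J f x).range ⊔
        (modelDeriv K J (Subtype.val : Z → Y) ⟨f x, hfZ⟩).range := by
      rw [ht]; trivial
    obtain ⟨_, ⟨v, rfl⟩, w, hw, rfl⟩ := Submodule.mem_sup.1 hy
    refine ⟨modelDeriv I 𝓘(ℝ, E) (φ.extend I) x v, ?_⟩
    rw [map_add, map_add, (hmem w).1 hw, add_zero]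
    exact congrArg P (key v)
  · intro hs
    refine eq_top_iff.2 fun y _ => ?_
    obtain ⟨u, hu⟩ := hs (P (modelDeriv J 𝓘(ℝ, E') (ψ.extend J) (f x) y))
    obtain ⟨v, rfl⟩ := hφ' u
    refine Submodule.mem_sup.2 ⟨modelDeriv I J f x v, ⟨v, rfl⟩, y - modelDeriv I J f x v, ?_,
      by abel⟩
    rw [hmem, map_sub, map_sub, ← hu, ContinuousLinearMap.comp_apply, key v, sub_self]

/-- In the normal form of an immersion the inclusion is `u ↦ e (u, 0)`, and `P` is the second
component of `e.symm`. At corners `Z` may fill only part of the kernel of `P`, but its tangent space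
is still the whole kernel, so transversality does not see the difference. -/
theorem exists_isDefiningMap [FiniteDimensional ℝ E']
    (hZ : Manifold.IsSmoothEmbedding K J ∞ (Subtype.val : Z → Y)) {z₀ : Y} (hz₀ : z₀ ∈ Z) :
    ∃ (C : Type v) (_ : NormedAddCommGroup C) (_ : NormedSpace ℝ C) (_ : FiniteDimensional ℝ C)
      (ψ : OpenPartialHomeomorph Y H') (P : E' →L[ℝ] C) (N : Set Y),
      z₀ ∈ N ∧ IsDefiningMap J K Z ψ P N := by
  obtain ⟨C, _, _, d, ψ, hz₀d, hz₀ψ, hd, hψ, -, e, he⟩ := hZ.isImmersion.isImmersionAt ⟨z₀, hz₀⟩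
  let P : E' →L[ℝ] C := ContinuousLinearMap.snd ℝ F C ∘L (e.symm : E' →L[ℝ] F × C)
  have hPs : Surjective P := fun c => ⟨e (0, c), by simp [P]⟩
  have hC : FiniteDimensional ℝ C := Module.Finite.of_surjective P.toLinearMap hPs
  have hval : ∀ z ∈ d.source, ψ.extend J z.1 = e (d.extend K z, 0) := by
    intro z hz
    have := he ((d.extend K).map_source (by rwa [d.extend_source]))
    rwa [comp_apply, comp_apply, d.extend_left_inv hz] at this
  -- `Z` carries the subspace topology, so the chart domain is the trace of an open `N'`; no other
  -- sheet of `Z` meets `N'`.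
  obtain ⟨N', hN', hdN⟩ := isOpen_induced_iff.1 d.open_source
  refine ⟨C, inferInstance, inferInstance, hC, ψ, P, N' ∩ ψ.source, ⟨?_, hz₀ψ⟩, hψ, hPs,
    hN'.inter ψ.open_source, inter_subset_right, ?_, ?_⟩
  · have : (⟨z₀, hz₀⟩ : Z) ∈ Subtype.val ⁻¹' N' := hdN ▸ hz₀d
    exact this
  · intro y hy hyZ
    have hyd : (⟨y, hyZ⟩ : Z) ∈ d.source := by rw [← hdN]; exact hy.1
    have := hval _ hyd
    simp only at this
    rw [this]
    simp [P]
  · intro y hy hyZ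
    set z : Z := ⟨y, hyZ⟩ with hz
    have hzd : z ∈ d.source := by rw [← hdN]; exact hy.1
    have hsm : MDifferentiableAt K J (Subtype.val : Z → Y) z :=
      (hZ.contMDiff z).mdifferentiableAt (by simp)
    have h1 : (ψ.extend J ∘ (Subtype.val : Z → Y)) =ᶠ[𝓝 z]
        ((e : F × C →L[ℝ] E') ∘L ContinuousLinearMap.inl ℝ F C) ∘ d.extend K := by
      filter_upwards [d.open_source.mem_nhds hzd] with q hq
      rw [comp_apply, hval q hq]
      simp
    have h2 := modelDeriv_congr (I := K) (J := 𝓘(ℝ, E')) h1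
    rw [modelDeriv_comp z (mdifferentiableAt_extend hψ hy.2) hsm,
      modelDeriv_comp z (ContinuousLinearMap.mdifferentiableAt _) (mdifferentiableAt_extend hd hzd),
      modelDeriv_eq_fderiv, ContinuousLinearMap.fderiv] at h2
    have h3 := fun v => DFunLike.congr_fun h2 v
    simp only [ContinuousLinearMap.comp_apply] at h3
    intro v
    constructor
    · rintro ⟨w, rfl⟩
      refine (congrArg P (h3 w)).trans ?_
      simp [P]
    · intro hv
      obtain ⟨w, hw⟩ := surjective_modelDeriv_extend hd hzd
        (e.symm (modelDeriv J 𝓘(ℝ, E') (ψ.extend J) y v)).1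
      refine ⟨w, (bijective_modelDeriv_extend hψ hy.2).1 ((h3 w).trans ?_)⟩
      rw [hw]
      apply e.symm.injective
      refine Prod.ext (by simp) ?_
      simpa [P] using hv.symm

end DefiningMap

/-! ### Openness of transversality in the weak topology -/

section WeakTopology

open Set Function Filter

universe v

variable {E F H H' G : Type*} {E' : Type v}
  [NormedAddCommGroup E] [NormedSpace ℝ E] [NormedAddCommGroup E'] [NormedSpace ℝ E']
  [NormedAddCommGroup F] [NormedSpace ℝ F]
  [TopologicalSpace H] [TopologicalSpace H'] [TopologicalSpace G]
  {I : ModelWithCorners ℝ E H} {J : ModelWithCorners ℝ E' H'} {K : ModelWithCorners ℝ F G}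
  {X Y : Type*} [TopologicalSpace X] [ChartedSpace H X] [TopologicalSpace Y] [ChartedSpace H' Y]
  {Z : Set Y} [ChartedSpace G Z]

theorem norm_fderiv_sub_le_iteratedFDeriv_one {f g : E → E'} {x y : E} :
    ‖fderiv ℝ f x - fderiv ℝ g y‖ ≤ ‖iteratedFDeriv ℝ 1 f x - iteratedFDeriv ℝ 1 g y‖ := by
  refine ContinuousLinearMap.opNorm_le_bound _ (norm_nonneg _) fun v => ?_
  have := (iteratedFDeriv ℝ 1 f x - iteratedFDeriv ℝ 1 g y).le_opNorm (fun _ => v)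
  simpa [iteratedFDeriv_one_apply] using this

variable [LocallyCompactSpace X] [I.Boundaryless]
  {φ : OpenPartialHomeomorph X H} {ψ : OpenPartialHomeomorph Y H'}

/-- This is the only direct use of the subbasic neighborhoods; order `r = 1` on a compact
neighborhood of `x₀` is enough. Both maps are compared at the same moving point, and continuity of
`f₀` and its derivative is added afterwards. -/
theorem eventually_writtenInCharts_near (hφ : φ ∈ IsManifold.maximalAtlas I ∞ X)
    (hψ : ψ ∈ IsManifold.maximalAtlas J ∞ Y) (f₀ : C^∞⟮I, X; J, Y⟯) {x₀ : X}
    (hx₀ : x₀ ∈ φ.source) (hf₀ : f₀ x₀ ∈ ψ.source) {ε : ℝ} (hε : 0 < ε) :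
    ∀ᶠ p : C^∞⟮I, X; J, Y⟯ × X in 𝓝 (f₀, x₀), p.2 ∈ φ.source ∧ p.1 p.2 ∈ ψ.source ∧
      ‖ψ.extend J (p.1 p.2) - ψ.extend J (f₀ p.2)‖ < ε ∧
      ‖fderiv ℝ (ψ.extend J ∘ p.1 ∘ (φ.extend I).symm) (φ.extend I p.2) -
        fderiv ℝ (ψ.extend J ∘ f₀ ∘ (φ.extend I).symm) (φ.extend I p.2)‖ < ε := by
  have hopen : φ.source ∩ f₀ ⁻¹' ψ.source ∈ 𝓝 x₀ :=
    inter_mem (φ.open_source.mem_nhds hx₀)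
      (f₀.contMDiff.continuous.continuousAt.preimage_mem_nhds (ψ.open_source.mem_nhds hf₀))
  obtain ⟨T, hT, hTs, hTc⟩ := local_compact_nhds hopen
  have hN : IsOpen (smoothNhd f₀ φ ψ T 1 ε) :=
    TopologicalSpace.isOpen_generateFrom_of_mem ⟨f₀, φ, ψ, T, 1, ε, hφ, hψ, hTc,
      fun x hx => (hTs hx).1, fun x hx => (hTs hx).2, hε, rfl⟩
  have hmem : f₀ ∈ smoothNhd f₀ φ ψ T 1 ε :=
    ⟨fun x hx => (hTs hx).2, fun x _ k _ => by simpa using hε⟩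
  rw [nhds_prod_eq]
  filter_upwards [prod_mem_prod (hN.mem_nhds hmem) hT]
  rintro ⟨f, x⟩ ⟨⟨hfm, hf⟩, hx⟩
  have hsymm : (φ.extend I).symm (φ.extend I x) = x := φ.extend_left_inv (hTs hx).1
  refine ⟨(hTs hx).1, hfm hx, ?_, ?_⟩
  · have h0 := hf x hx 0 zero_le_one
    simp only [I.range_eq_univ, iteratedFDerivWithin_univ, iteratedFDeriv_zero_eq_comp,
      comp_apply, ← map_sub, LinearIsometryEquiv.norm_map, hsymm] at h0
    exact h0
  · have h1 := hf x hx 1 le_rfl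
    rw [I.range_eq_univ, iteratedFDerivWithin_univ, iteratedFDerivWithin_univ] at h1
    exact norm_fderiv_sub_le_iteratedFDeriv_one.trans_lt h1

theorem tendsto_eval (hφ : φ ∈ IsManifold.maximalAtlas I ∞ X)
    (hψ : ψ ∈ IsManifold.maximalAtlas J ∞ Y) (f₀ : C^∞⟮I, X; J, Y⟯) {x₀ : X}
    (hx₀ : x₀ ∈ φ.source) (hf₀ : f₀ x₀ ∈ ψ.source) :
    Tendsto (fun p : C^∞⟮I, X; J, Y⟯ × X => p.1 p.2) (𝓝 (f₀, x₀)) (𝓝 (f₀ x₀)) := by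
  have hc : ContinuousAt (fun x => ψ.extend J (f₀ x)) x₀ :=
    ContinuousAt.comp (g := ψ.extend J) (ψ.continuousAt_extend hf₀)
      f₀.contMDiff.continuous.continuousAt
  have h1 : Tendsto (fun p : C^∞⟮I, X; J, Y⟯ × X => ψ.extend J (p.1 p.2)) (𝓝 (f₀, x₀))
      (𝓝 (ψ.extend J (f₀ x₀))) := by
    have h2 : Tendsto (fun p : C^∞⟮I, X; J, Y⟯ × X => ψ.extend J (f₀ p.2)) (𝓝 (f₀, x₀))
        (𝓝 (ψ.extend J (f₀ x₀))) := hc.tendsto.comp continuousAt_snd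
    have h3 : Tendsto (fun p : C^∞⟮I, X; J, Y⟯ × X =>
        ψ.extend J (p.1 p.2) - ψ.extend J (f₀ p.2)) (𝓝 (f₀, x₀)) (𝓝 0) := by
      rw [Metric.tendsto_nhds]
      intro ε hε
      filter_upwards [eventually_writtenInCharts_near hφ hψ f₀ hx₀ hf₀ hε] with p hp
      simpa using hp.2.2.1
    simpa using h3.add h2
  have h4 := (ψ.continuousAt_extend_symm (I := J) hf₀).tendsto.comp h1
  rw [ψ.extend_left_inv hf₀] at h4
  refine h4.congr' ?_
  filter_upwards [eventually_writtenInCharts_near hφ hψ f₀ hx₀ hf₀ one_pos] with p hp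
  exact ψ.extend_left_inv hp.2.1

theorem tendsto_fderiv_writtenInCharts (hφ : φ ∈ IsManifold.maximalAtlas I ∞ X)
    (hψ : ψ ∈ IsManifold.maximalAtlas J ∞ Y) (f₀ : C^∞⟮I, X; J, Y⟯) {x₀ : X}
    (hx₀ : x₀ ∈ φ.source) (hf₀ : f₀ x₀ ∈ ψ.source) :
    Tendsto (fun p : C^∞⟮I, X; J, Y⟯ × X =>
        fderiv ℝ (ψ.extend J ∘ p.1 ∘ (φ.extend I).symm) (φ.extend I p.2))
      (𝓝 (f₀, x₀)) (𝓝 (fderiv ℝ (ψ.extend J ∘ f₀ ∘ (φ.extend I).symm) (φ.extend I x₀))) := by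
  have hsymm : (φ.extend I).symm (φ.extend I x₀) = x₀ := φ.extend_left_inv hx₀
  have hW : IsOpen ((φ.extend I).target ∩ (f₀ ∘ (φ.extend I).symm) ⁻¹' ψ.source) :=
    (f₀.contMDiff.continuous.comp_continuousOn (φ.continuousOn_extend_symm (I := I))
      ).isOpen_inter_preimage φ.isOpen_extend_target ψ.open_source
  have hxW : φ.extend I x₀ ∈ (φ.extend I).target ∩ (f₀ ∘ (φ.extend I).symm) ⁻¹' ψ.source :=
    ⟨(φ.extend I).map_source (by rwa [φ.extend_source]), by rwa [mem_preimage, comp_apply, hsymm]⟩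
  have hc : ContinuousAt (fun x =>
      fderiv ℝ (ψ.extend J ∘ f₀ ∘ (φ.extend I).symm) (φ.extend I x)) x₀ :=
    ContinuousAt.comp (g := fderiv ℝ (ψ.extend J ∘ f₀ ∘ (φ.extend I).symm))
      (((contDiffOn_writtenInCharts hφ hψ f₀.contMDiff).continuousOn_fderiv_of_isOpen hW
        (by simp)).continuousAt (hW.mem_nhds hxW)) (φ.continuousAt_extend hx₀)
  have h2 := hc.tendsto.comp
    (continuousAt_snd : ContinuousAt (Prod.snd : C^∞⟮I, X; J, Y⟯ × X → X) (f₀, x₀))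
  have h3 : Tendsto (fun p : C^∞⟮I, X; J, Y⟯ × X =>
      fderiv ℝ (ψ.extend J ∘ p.1 ∘ (φ.extend I).symm) (φ.extend I p.2) -
        fderiv ℝ (ψ.extend J ∘ f₀ ∘ (φ.extend I).symm) (φ.extend I p.2)) (𝓝 (f₀, x₀)) (𝓝 0) := by
    rw [Metric.tendsto_nhds]
    intro ε hε
    filter_upwards [eventually_writtenInCharts_near hφ hψ f₀ hx₀ hf₀ hε] with p hp
    simpa using hp.2.2.2
  simpa [comp_def] using h3.add h2

variable [IsManifold I ∞ X] [IsManifold J ∞ Y]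

/-- The evaluation map is continuous. -/
theorem continuous_eval_smooth : Continuous fun p : C^∞⟮I, X; J, Y⟯ × X => p.1 p.2 :=
  continuous_iff_continuousAt.2 fun ⟨f₀, x₀⟩ => tendsto_eval
    (IsManifold.chart_mem_maximalAtlas x₀) (IsManifold.chart_mem_maximalAtlas (f₀ x₀)) f₀
    (mem_chart_source H x₀) (mem_chart_source H' (f₀ x₀))

variable [FiniteDimensional ℝ E']

/-- In the setting of a defining map, transversality at a point is inherited by nearby maps at
nearby points, in the form of surjectivity of the differential of the defining map. -/
theorem IsDefiningMap.eventually_surjective {C : Type*} [NormedAddCommGroup C] [NormedSpace ℝ C]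
    [FiniteDimensional ℝ C] {P : E' →L[ℝ] C} {N : Set Y} (h : IsDefiningMap J K Z ψ P N)
    (hφ : φ ∈ IsManifold.maximalAtlas I ∞ X) {f₀ : C^∞⟮I, X; J, Y⟯} {x₀ : X}
    (hx₀ : x₀ ∈ φ.source) (hN : f₀ x₀ ∈ N) (hZ : f₀ x₀ ∈ Z)
    (ht : IsTransversalAt I J K Z f₀ x₀) :
    ∀ᶠ p : C^∞⟮I, X; J, Y⟯ × X in 𝓝 (f₀, x₀), p.2 ∈ φ.source ∧ p.1 p.2 ∈ N ∧
      Surjective (P ∘L fderiv ℝ (ψ.extend J ∘ p.1 ∘ (φ.extend I).symm) (φ.extend I p.2)) := by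
  have hs := (h.isTransversalAt_iff hφ
    (f₀.contMDiff.mdifferentiable (by simp) x₀) hx₀ hN hZ).1 ht
  have h1 := tendsto_fderiv_writtenInCharts hφ h.mem_maximalAtlas f₀ hx₀ (h.subset_source hN)
  have hc : Continuous fun D : E →L[ℝ] E' => P ∘L D := by fun_prop
  have h2 := (hc.tendsto _).comp h1
  filter_upwards [h2.eventually (isOpen_setOf_surjective_clm.mem_nhds hs),
    continuous_eval_smooth.continuousAt.eventually (h.isOpen.mem_nhds hN),
    continuousAt_snd.eventually (φ.open_source.mem_nhds hx₀)] with p hp1 hp2 hp3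
  exact ⟨hp3, hp2, hp1⟩

/-- Transversality at a point that is mapped into `Z` is an open condition. -/
theorem eventually_isTransversalAt
    (hZ : Manifold.IsSmoothEmbedding K J ∞ (Subtype.val : Z → Y))
    {f₀ : C^∞⟮I, X; J, Y⟯} {x₀ : X} (hx₀ : f₀ x₀ ∈ Z) (ht : IsTransversalAt I J K Z f₀ x₀) :
    ∀ᶠ p : C^∞⟮I, X; J, Y⟯ × X in 𝓝 (f₀, x₀), IsTransversalAt I J K Z p.1 p.2 := by
  obtain ⟨C, _, _, _, ψ, P, N, hN, h⟩ := exists_isDefiningMap hZ hx₀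
  filter_upwards [h.eventually_surjective (IsManifold.chart_mem_maximalAtlas x₀)
    (mem_chart_source H x₀) hN hx₀ ht] with p hp
  intro hpZ
  exact (h.isTransversalAt_iff (IsManifold.chart_mem_maximalAtlas x₀)
    (p.1.contMDiff.mdifferentiable (by simp) p.2) hp.1 hp.2.1 hpZ).2 hp.2.2 hpZ

/-- The closed set `Q` removes the obstruction to openness: nearby points could be mapped into a
non-closed `Z` when `f₀ x₀` is outside it, but not into `Q` when `f₀ x₀` is outside `Q`. -/
theorem eventually_isTransversalAt_of_isClosed
    (hZ : Manifold.IsSmoothEmbedding K J ∞ (Subtype.val : Z → Y)) {Q : Set Y} (hQ : IsClosed Q)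
    (hQZ : Q ⊆ Z) {f₀ : C^∞⟮I, X; J, Y⟯} {x₀ : X}
    (ht : f₀ x₀ ∈ Q → IsTransversalAt I J K Z f₀ x₀) :
    ∀ᶠ p : C^∞⟮I, X; J, Y⟯ × X in 𝓝 (f₀, x₀),
      p.1 p.2 ∈ Q → IsTransversalAt I J K Z p.1 p.2 := by
  by_cases hx₀ : f₀ x₀ ∈ Q
  · filter_upwards [eventually_isTransversalAt hZ (hQZ hx₀) (ht hx₀)] with p hp _ using hp
  · filter_upwards [continuous_eval_smooth.continuousAt.eventually
      (hQ.isOpen_compl.mem_nhds hx₀)] with p hp hpQ using absurd hpQ hp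

theorem isOpen_setOf_isTransversalAt
    (hZ : Manifold.IsSmoothEmbedding K J ∞ (Subtype.val : Z → Y)) {Q : Set Y} (hQ : IsClosed Q)
    (hQZ : Q ⊆ Z) {T : Set X} (hT : IsCompact T) :
    IsOpen {f : C^∞⟮I, X; J, Y⟯ | ∀ x ∈ T, f x ∈ Q → IsTransversalAt I J K Z f x} :=
  isOpen_iff_mem_nhds.2 fun _ hf => hT.eventually_forall_of_forall_eventually fun x hx =>
    eventually_isTransversalAt_of_isClosed hZ hQ hQZ (hf x hx)

end WeakTopology

/-! ### Transversal partial maps and local density -/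

section ParametricTransversality

open Set Function Filter MeasureTheory TopologicalSpace

universe v

variable {E F H H' G : Type*} {E' : Type v}
  [NormedAddCommGroup E] [NormedSpace ℝ E] [FiniteDimensional ℝ E]
  [NormedAddCommGroup E'] [NormedSpace ℝ E'] [FiniteDimensional ℝ E']
  [NormedAddCommGroup F] [NormedSpace ℝ F]
  [TopologicalSpace H] [TopologicalSpace H'] [TopologicalSpace G]
  {I : ModelWithCorners ℝ E H} {J : ModelWithCorners ℝ E' H'} {K : ModelWithCorners ℝ F G}
  {X Y : Type*} [TopologicalSpace X] [ChartedSpace H X] [TopologicalSpace Y] [ChartedSpace H' Y]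
  {Z : Set Y} [ChartedSpace G Z] [I.Boundaryless] [IsManifold I ∞ X]

/-- If the differential of a defining map of `Z` along `f : S × X → Y` is onto on `S' × T`, then
some partial map `f (s, ·)` with `s ∈ S'` is transversal to `Z` on `T`. -/
theorem IsDefiningMap.exists_isTransversalAt_partial {V : Type*} [NormedAddCommGroup V]
    [NormedSpace ℝ V] [FiniteDimensional ℝ V] {S : Opens V} {C : Type*} [NormedAddCommGroup C]
    [NormedSpace ℝ C] [FiniteDimensional ℝ C] {ψ : OpenPartialHomeomorph Y H'} {P : E' →L[ℝ] C}
    {N : Set Y} (hP : IsDefiningMap J K Z ψ P N)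
    (f : C^∞⟮𝓘(ℝ, V).prod I, S × X; J, Y⟯) {s₀ : S} {x₀ : X} {S' : Set S} (hS' : IsOpen S')
    (hs₀ : s₀ ∈ S') {T : Set X} (hT : IsOpen T)
    (h : ∀ s ∈ S', ∀ x ∈ T, (s, x) ∈ (chartAt (ModelProd V H) (s₀, x₀)).source ∧ f (s, x) ∈ N ∧
      Surjective (P ∘L fderiv ℝ (ψ.extend J ∘ f ∘
        ((chartAt (ModelProd V H) (s₀, x₀)).extend (𝓘(ℝ, V).prod I)).symm)
        ((chartAt (ModelProd V H) (s₀, x₀)).extend (𝓘(ℝ, V).prod I) (s, x)))) :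
    ∃ s ∈ S', ∀ x ∈ T, IsTransversalAt I J K Z (fun x => f (s, x)) x := by
  set χ := chartAt (ModelProd V H) (s₀, x₀) with hχ
  set φ := chartAt H x₀ with hφ
  have hχm : χ ∈ IsManifold.maximalAtlas (𝓘(ℝ, V).prod I) ∞ (S × X) :=
    IsManifold.chart_mem_maximalAtlas _
  have hφm : φ ∈ IsManifold.maximalAtlas I ∞ X := IsManifold.chart_mem_maximalAtlas _
  have hχapp : ∀ s x, χ.extend (𝓘(ℝ, V).prod I) (s, x) = ((s : V), φ.extend I x) :=
    fun s x => rfl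
  have hχsymm : ∀ (s : S) y, (χ.extend (𝓘(ℝ, V).prod I)).symm ((s : V), y) =
      (s, (φ.extend I).symm y) := by
    intro s y
    refine Prod.ext ?_ rfl
    exact ((chartAt V s₀.1).subtypeRestr ⟨s₀⟩).left_inv ⟨trivial, by rw [chartAt_self_eq]; trivial⟩
  set r := ψ.extend J ∘ f ∘ (χ.extend (𝓘(ℝ, V).prod I)).symm with hr
  set W := (χ.extend (𝓘(ℝ, V).prod I)).target ∩
    (χ.extend (𝓘(ℝ, V).prod I)).symm ⁻¹' (S' ×ˢ T) with hW
  have hWo : IsOpen W :=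
    (χ.continuousOn_extend_symm (I := 𝓘(ℝ, V).prod I)).isOpen_inter_preimage
      χ.isOpen_extend_target (hS'.prod hT)
  have hrW : ContDiffOn ℝ ∞ r W :=
    (contDiffOn_writtenInCharts hχm hP.mem_maximalAtlas f.contMDiff).mono fun p hp =>
      ⟨hp.1, hP.subset_source (h _ hp.2.1 _ hp.2.2).2.1⟩
  have hrd : ∀ p ∈ W, DifferentiableAt ℝ r p := fun p hp =>
    (hrW.contDiffAt (hWo.mem_nhds hp)).differentiableAt (by simp)
  have hgd : ∀ p ∈ W, fderiv ℝ (P ∘ r) p = P ∘L fderiv ℝ r p := fun p hp =>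
    (P.hasFDerivAt.comp p (hrd p hp).hasFDerivAt).fderiv
  borelize V
  have hnull := measure_not_surjective_fderiv_inr_null (Measure.addHaar : Measure V) hWo
    (P.contDiff.comp_contDiffOn hrW) (fun p hp _ => by
      rw [hgd p hp]
      have := (h _ hp.2.1 _ hp.2.2).2.2
      rwa [Prod.mk.eta, (χ.extend (𝓘(ℝ, V).prod I)).right_inv hp.1] at this)
  -- A nonempty open set has positive Haar measure, so the null set of bad parameters cannot contain
  -- it.
  have hpos : 0 < (Measure.addHaar : Measure V) (Subtype.val '' S') :=
    (S.isOpen.isOpenMap_subtype_val S' hS').measure_pos _ ⟨_, s₀, hs₀, rfl⟩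
  obtain ⟨_, ⟨s, hs, rfl⟩, hgood⟩ : ∃ s ∈ Subtype.val '' S', s ∉ {s | ∃ x, (s, x) ∈ W ∧
      (P ∘ r) (s, x) = 0 ∧
      ¬ Surjective (fderiv ℝ (P ∘ r) (s, x) ∘L ContinuousLinearMap.inr ℝ V E)} := by
    by_contra! hcon
    exact hpos.ne' (measure_mono_null hcon hnull)
  refine ⟨s, hs, fun x hx hfZ => ?_⟩
  obtain ⟨hsrc, hN, -⟩ := h s hs x hx
  have hxφ : x ∈ φ.source := hsrc.2
  have hsymm : (χ.extend (𝓘(ℝ, V).prod I)).symm ((s : V), φ.extend I x) = (s, x) := by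
    rw [hχsymm, φ.extend_left_inv hxφ]
  have hpW : ((s : V), φ.extend I x) ∈ W := by
    refine ⟨?_, ?_⟩
    · rw [← hχapp]
      exact (χ.extend _).map_source (by rwa [χ.extend_source])
    · rw [mem_preimage, hsymm]
      exact ⟨hs, hx⟩
  -- Only this inclusion is needed: zeros of `P ∘ r` that do not come from `Z` are controlled as
  -- well, which does no harm.
  have hzero : (P ∘ r) ((s : V), φ.extend I x) = 0 := by
    rw [comp_apply, hr, comp_apply, comp_apply, hsymm]
    exact hP.apply_eq_zero _ hN hfZ
  have hsurj : Surjective (fderiv ℝ (P ∘ r) ((s : V), φ.extend I x) ∘L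
      ContinuousLinearMap.inr ℝ V E) := by
    by_contra hcon
    exact hgood ⟨φ.extend I x, hpW, hzero, hcon⟩
  have hsm : ContMDiff I J ∞ fun x => f (s, x) :=
    f.contMDiff.comp (contMDiff_const.prodMk contMDiff_id)
  refine (hP.isTransversalAt_iff hφm (hsm.mdifferentiable (by simp) x) hxφ hN hfZ).2 ?_ hfZ
  have hpart : ψ.extend J ∘ (fun x => f (s, x)) ∘ (φ.extend I).symm =
      r ∘ fun y => ((s : V), y) := by
    funext y
    simp only [hr, comp_apply, hχsymm]
  have hd : HasFDerivAt (r ∘ fun y => ((s : V), y)) (fderiv ℝ r ((s : V), φ.extend I x) ∘L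
      ContinuousLinearMap.inr ℝ V E) (φ.extend I x) :=
    HasFDerivAt.comp _ (hrd _ hpW).hasFDerivAt (hasFDerivAt_prodMk_right _ _)
  rw [hpart, hd.fderiv]
  rwa [hgd _ hpW] at hsurj

variable [IsManifold J ∞ Y]

/-- Density is stated locally, for an open `O` on a neighborhood of `b₀` and a neighborhood `T` of
`x₀`, so that finitely many instances can be combined over a compact set. -/
theorem exists_isOpen_isTransversalAt_near [LocallyCompactSpace X]
    (hZ : Manifold.IsSmoothEmbedding K J ∞ (Subtype.val : Z → Y)) {Q : Set Y} (hQ : IsClosed Q)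
    (hQZ : Q ⊆ Z) {B : Type*} [TopologicalSpace B] {Φ : B → C^∞⟮I, X; J, Y⟯} (hΦ : Continuous Φ)
    (b₀ : B) (x₀ : X)
    (hβ : ¬ IsTransversalAt I J K Z (Φ b₀) x₀ →
      ∃ (n : ℕ) (S : Opens (EuclideanSpace ℝ (Fin n))) (hS : 0 ∈ S) (U : Opens B) (hU : b₀ ∈ U)
        (β : U × S → B), Continuous β ∧ (∀ b : U, β (b, ⟨0, hS⟩) = b) ∧
        ∃ Ψ : U → C^∞⟮𝓘(ℝ, EuclideanSpace ℝ (Fin n)).prod I, S × X; J, Y⟯,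
          (∀ (b : U) (s : S) (x : X), Ψ b (s, x) = Φ (β (b, s)) x) ∧ Continuous Ψ ∧
          IsTransversalAt (𝓘(ℝ, EuclideanSpace ℝ (Fin n)).prod I) J K Z
            (Ψ ⟨b₀, hU⟩) (⟨0, hS⟩, x₀)) :
    ∃ T ∈ 𝓝 x₀, ∃ U ∈ 𝓝 b₀, ∃ O : Set B, IsOpen O ∧ U ⊆ closure O ∧
      ∀ b ∈ O, ∀ x ∈ T, Φ b x ∈ Q → IsTransversalAt I J K Z (Φ b) x := by
  by_cases ht : IsTransversalAt I J K Z (Φ b₀) x₀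
  · have h1 := eventually_isTransversalAt_of_isClosed hZ hQ hQZ (fun _ => ht)
    have h2 : ∀ᶠ p : B × X in 𝓝 (b₀, x₀), Φ p.1 p.2 ∈ Q → IsTransversalAt I J K Z (Φ p.1) p.2 :=
      (((hΦ.comp continuous_fst).prodMk continuous_snd).tendsto (b₀, x₀)).eventually h1
    rw [nhds_prod_eq] at h2
    obtain ⟨U, hU, T, hT, hUT⟩ := mem_prod_iff.1 h2
    refine ⟨T, hT, interior U, interior_mem_nhds.2 hU, interior U, isOpen_interior,
      subset_closure, fun b hb x hx => ?_⟩
    exact hUT (show (b, x) ∈ U ×ˢ T from ⟨interior_subset hb, hx⟩)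
  obtain ⟨n, S, hS, U, hU, β, hβc, hβ0, Ψ, hΨ, hΨc, hΨt⟩ := hβ ht
  have hz₀ : Φ b₀ x₀ ∈ Z := by
    by_contra hcon
    exact ht fun hx => absurd hx hcon
  have hΨ0 : Ψ ⟨b₀, hU⟩ (⟨0, hS⟩, x₀) = Φ b₀ x₀ := by rw [hΨ, hβ0]
  obtain ⟨C, _, _, _, ψ, P, N, hN, hP⟩ := exists_isDefiningMap hZ hz₀
  have : LocallyCompactSpace S := S.isOpen.isLocallyClosed.locallyCompactSpace
  have h1 := hP.eventually_surjective (I := 𝓘(ℝ, EuclideanSpace ℝ (Fin n)).prod I)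
    (IsManifold.chart_mem_maximalAtlas ((⟨0, hS⟩ : S), x₀))
    (mem_chart_source (ModelProd (EuclideanSpace ℝ (Fin n)) H) _)
    (by rwa [hΨ0]) (by rwa [hΨ0]) hΨt
  have h2 := (((hΨc.comp continuous_fst).prodMk continuous_snd).tendsto
    ((⟨b₀, hU⟩ : U), ((⟨0, hS⟩ : S), x₀))).eventually h1
  rw [nhds_prod_eq] at h2
  obtain ⟨U', hU', R, hR, hUR⟩ := mem_prod_iff.1 h2
  rw [nhds_prod_eq] at hR
  obtain ⟨S', hS', T', hT', hST⟩ := mem_prod_iff.1 hR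
  -- `T` is compact to make the good set open, and lies inside the interior of `T'` because the
  -- partial-map statement needs an open set.
  obtain ⟨T, hT, hTT', hTc⟩ := local_compact_nhds (interior_mem_nhds.2 hT')
  refine ⟨T, hT, Subtype.val '' U', ?_, {b | ∀ x ∈ T, Φ b x ∈ Q → IsTransversalAt I J K Z (Φ b) x},
    (isOpen_setOf_isTransversalAt hZ hQ hQZ hTc).preimage hΦ, ?_, fun b hb => hb⟩
  · exact U.isOpen.isOpenMap_subtype_val.image_mem_nhds hU'
  rintro _ ⟨b, hb, rfl⟩
  refine mem_closure_iff_nhds.2 fun V hV => ?_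
  have hβb : ContinuousAt (fun s => β (b, s)) ⟨0, hS⟩ :=
    (hβc.comp (Continuous.prodMk_right b)).continuousAt
  have hV' : (fun s => β (b, s)) ⁻¹' V ∈ 𝓝 (⟨0, hS⟩ : S) :=
    hβb.preimage_mem_nhds (by rwa [hβ0])
  -- The parameter set is shrunk so that `β (b, s)` lies in the prescribed neighborhood `V` of `b`;
  -- `T'` and `S'` do not depend on `b`.
  obtain ⟨s, hs, hst⟩ := hP.exists_isTransversalAt_partial (I := I) (Ψ b)
    (x₀ := x₀) (s₀ := ⟨0, hS⟩) (isOpen_interior (s := S' ∩ (fun s => β (b, s)) ⁻¹' V))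
    (mem_interior_iff_mem_nhds.2 (inter_mem hS' hV')) (isOpen_interior (s := T'))
    fun s hs x hx => hUR (show (b, (s, x)) ∈ U' ×ˢ R from
      ⟨hb, hST ⟨(interior_subset hs).1, interior_subset hx⟩⟩)
  refine ⟨β (b, s), (interior_subset hs).2, fun x hx _ => ?_⟩
  have heq : (fun x => Ψ b (s, x)) = Φ (β (b, s)) := funext fun x => hΨ b s x
  rw [← heq]
  exact hst x (hTT' hx)

end ParametricTransversality

/-! ### From local density to a residual set -/

theorem inter_subset_closure_inter_of_isOpen {B : Type*} [TopologicalSpace B] {U O₁ O₂ : Set B}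
    (hU : IsOpen U) (hO₁ : IsOpen O₁) (h₁ : U ⊆ closure O₁) (h₂ : U ⊆ closure O₂) :
    U ⊆ closure (O₁ ∩ O₂) := by
  intro b hb
  rw [mem_closure_iff]
  intro V hV hbV
  obtain ⟨c, ⟨hcV, hcU⟩, hc⟩ := mem_closure_iff.1 (h₁ hb) (V ∩ U) (hV.inter hU) ⟨hbV, hb⟩
  obtain ⟨d, ⟨hdV, hd⟩, hd'⟩ := mem_closure_iff.1 (h₂ hcU) (V ∩ O₁) (hV.inter hO₁) ⟨hcV, hc⟩
  exact ⟨d, hdV, hd, hd'⟩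

theorem lemma5p2
    {B : Type*} [TopologicalSpace B] [BaireSpace B]
    -- `X` and `Y` are smooth manifolds without boundary
    {E : Type*} [NormedAddCommGroup E] [NormedSpace ℝ E] [FiniteDimensional ℝ E]
    {X : Type*} [TopologicalSpace X] [T2Space X] [SecondCountableTopology X]
    [ChartedSpace E X] [IsManifold 𝓘(ℝ, E) ∞ X]
    {E' : Type*} [NormedAddCommGroup E'] [NormedSpace ℝ E'] [FiniteDimensional ℝ E']
    {Y : Type*} [TopologicalSpace Y] [T2Space Y] [SecondCountableTopology Y]
    [ChartedSpace E' Y] [IsManifold 𝓘(ℝ, E') ∞ Y]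
    -- `Z` is an embedded submanifold of `Y`, possibly with boundary or corners
    {F : Type*} [NormedAddCommGroup F] [NormedSpace ℝ F] [FiniteDimensional ℝ F]
    {G : Type*} [TopologicalSpace G] (K : ModelWithCorners ℝ F G)
    (Z : Set Y) [ChartedSpace G Z] [IsManifold K ∞ Z]
    (hZ : Manifold.IsSmoothEmbedding K 𝓘(ℝ, E') ∞ (Subtype.val : Z → Y))
    (Φ : B → C^∞⟮𝓘(ℝ, E), X; 𝓘(ℝ, E'), Y⟯) (hΦ : Continuous Φ)
    (hβ : ∀ (b₀ : B) (x₀ : X), ¬ IsTransversalAt 𝓘(ℝ, E) 𝓘(ℝ, E') K Z (Φ b₀) x₀ →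
      ∃ (n : ℕ) (S : TopologicalSpace.Opens (EuclideanSpace ℝ (Fin n))) (hS : 0 ∈ S)
        (U : TopologicalSpace.Opens B) (hU : b₀ ∈ U) (β : U × S → B),
        Continuous β ∧
        (∀ b : U, β (b, ⟨0, hS⟩) = b) ∧
        ∃ Ψ : U → C^∞⟮𝓘(ℝ, EuclideanSpace ℝ (Fin n)).prod 𝓘(ℝ, E), S × X; 𝓘(ℝ, E'), Y⟯,
          (∀ (b : U) (s : S) (x : X), Ψ b (s, x) = Φ (β (b, s)) x) ∧
          Continuous Ψ ∧
          IsTransversalAt (𝓘(ℝ, EuclideanSpace ℝ (Fin n)).prod 𝓘(ℝ, E)) 𝓘(ℝ, E') K Z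
            (Ψ ⟨b₀, hU⟩) (⟨0, hS⟩, x₀)) :
    {b : B | IsTransversal 𝓘(ℝ, E) 𝓘(ℝ, E') K Z (Φ b)} ∈ residual B := by
  have : ProperSpace E := FiniteDimensional.proper ℝ E
  have : ProperSpace F := FiniteDimensional.proper ℝ F
  have : LocallyCompactSpace X := ChartedSpace.locallyCompactSpace E X
  have : LocallyCompactSpace G := K.locallyCompactSpace
  have : LocallyCompactSpace Z := ChartedSpace.locallyCompactSpace G Z
  -- The pieces of `Z` are compact, hence closed in the Hausdorff space `Y`, although `Z` itself
  -- need not be closed.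
  have hres : ∀ i j : ℕ, {b : B | ∀ x ∈ compactCovering X i,
      Φ b x ∈ Subtype.val '' compactCovering Z j →
        IsTransversalAt 𝓘(ℝ, E) 𝓘(ℝ, E') K Z (Φ b) x} ∈ residual B := by
    intro i j
    have hT := isCompact_compactCovering X i
    have hQ : IsClosed (Subtype.val '' compactCovering Z j : Set Y) :=
      ((isCompact_compactCovering Z j).image continuous_subtype_val).isClosed
    have hQZ : (Subtype.val '' compactCovering Z j : Set Y) ⊆ Z := by
      rintro _ ⟨z, -, rfl⟩
      exact z.2
    refine residual_of_dense_open ((isOpen_setOf_isTransversalAt hZ hQ hQZ hT).preimage hΦ)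
      fun b₀ => ?_
    obtain ⟨U, hU, O, -, hUO, hO⟩ : ∃ U ∈ 𝓝 b₀, ∃ O : Set B, IsOpen O ∧ U ⊆ closure O ∧
        ∀ b ∈ O, ∀ x ∈ compactCovering X i, Φ b x ∈ Subtype.val '' compactCovering Z j →
          IsTransversalAt 𝓘(ℝ, E) 𝓘(ℝ, E') K Z (Φ b) x := by
      -- Compactness induction: the property is local in `T` and passes to finite unions by
      -- intersecting the sets `O`, whose openness keeps the intersection dense near `b₀`.
      refine hT.induction_on (p := fun T : Set X => ∃ U ∈ 𝓝 b₀, ∃ O : Set B, IsOpen O ∧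
        U ⊆ closure O ∧ ∀ b ∈ O, ∀ x ∈ T, Φ b x ∈ Subtype.val '' compactCovering Z j →
          IsTransversalAt 𝓘(ℝ, E) 𝓘(ℝ, E') K Z (Φ b) x) ?_ ?_ ?_ ?_
      · exact ⟨Set.univ, Filter.univ_mem, Set.univ, isOpen_univ, subset_closure,
          fun b _ x hx => hx.elim⟩
      · rintro s t hst ⟨U, hU, O, hO, hUO, h⟩
        exact ⟨U, hU, O, hO, hUO, fun b hb x hx => h b hb x (hst hx)⟩
      · rintro s t ⟨U₁, hU₁, O₁, hO₁, hUO₁, h₁⟩ ⟨U₂, hU₂, O₂, hO₂, hUO₂, h₂⟩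
        refine ⟨interior (U₁ ∩ U₂), interior_mem_nhds.2 (Filter.inter_mem hU₁ hU₂), O₁ ∩ O₂,
          hO₁.inter hO₂, inter_subset_closure_inter_of_isOpen isOpen_interior hO₁
            (fun b hb => hUO₁ (interior_subset hb).1) (fun b hb => hUO₂ (interior_subset hb).2), ?_⟩
        rintro b hb x (hx | hx)
        · exact h₁ b hb.1 x hx
        · exact h₂ b hb.2 x hx
      · intro x₀ _
        obtain ⟨T, hT, h⟩ := exists_isOpen_isTransversalAt_near hZ hQ hQZ hΦ b₀ x₀ (hβ b₀ x₀)
        exact ⟨T, mem_nhdsWithin_of_mem_nhds hT, h⟩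
    exact closure_mono hO (hUO (mem_of_mem_nhds hU))
  filter_upwards [countable_iInter_mem.2 fun i => countable_iInter_mem.2 (hres i)]
  intro b hb x hx
  obtain ⟨i, hi⟩ := Set.mem_iUnion.1 (iUnion_compactCovering X ▸ Set.mem_univ x)
  obtain ⟨j, hj⟩ := Set.mem_iUnion.1 (iUnion_compactCovering Z ▸ Set.mem_univ (⟨Φ b x, hx⟩ : Z))
  exact Set.mem_iInter.1 (Set.mem_iInter.1 hb i) j x hi ⟨_, hj, rfl⟩ hx
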